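/- Let $d\lambda(z)=\frac1\pi e^{-|z|^2}\,dA(z)$ be the Gaussian measure on $\mathbb C$ ($dA$ is area measure) and let $F^2$ be the Fock space of all entire functions $f$ with $\|f\|^2=\int_{\mathbb C}|f|^2\,d\lambda<\infty$. The Bargmann transform $$Bf(z)=\left(\frac2\pi\right)^{1/4}\int_{\mathbb R}f(x)e^{2xz-x^2-z^2/2}\,dx$$ is a unitary operator from $L^2(\mathbb R)$ onto $F^2$, and the Hilbert transform $$Hf(x)=\frac1\pi\,\mathrm{p.v.}\!\int_{\mathbb R}\frac{f(t)}{t-x}\,dt$$ (the principal value existing for almost every $x$) is a bounded linear operator on $L^2(\mathbb R)$. Let $A(z)=\int_0^z e^{u^2}\,du$ be the antiderivative of $e^{z^2}$ with $A(0)=0$, and let $T=BHB^{-1}:F^2\to F^2$. Then, for all $f\in F^2$ and all $z\in\mathbb C$, $$Tf(z)=-\frac2{\sqrt\pi}\int_{\mathbb C}f(w)e^{z\overline w}A\left(\frac{z-\overline w}{\sqrt2}\right)d\lambda(w),$$ where the integral converges absolutely. -/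

import Mathlib

open MeasureTheory Filter Topology

noncomputable section

namespace Bargmann

/-- The Gaussian probability measure `dλ(z) = π⁻¹ exp (-|z|²) dA(z)` on the complex plane,
where `dA` is area measure. -/
def gaussian : Measure ℂ :=
  (volume : Measure ℂ).withDensity
    (fun z => ENNReal.ofReal (Real.pi⁻¹ * Real.exp (-‖z‖ ^ 2)))

/-- The entire functions that are square integrable with respect to `gaussian`. -/
def fockSubmodule : Submodule ℂ (ℂ → ℂ) where
  carrier := {f | Differentiable ℂ f ∧ MemLp f 2 gaussian}
  add_mem' hf hg := ⟨hf.1.add hg.1, hf.2.add hg.2⟩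
  zero_mem' := ⟨differentiable_const 0, MemLp.zero⟩
  smul_mem' a _ hf := ⟨hf.1.const_smul a, hf.2.const_smul a⟩

/-- The Fock space `F²`. Its elements are genuine functions `ℂ → ℂ`. -/
def FockSpace : Type := fockSubmodule

instance : AddCommGroup FockSpace := inferInstanceAs (AddCommGroup fockSubmodule)

instance : Module ℂ FockSpace := inferInstanceAs (Module ℂ fockSubmodule)

instance : CoeFun FockSpace (fun _ => ℂ → ℂ) := ⟨fun f => f.1⟩

/-- The inclusion of `F²` into `L²(ℂ, dλ)`. -/
def toL2 : FockSpace →ₗ[ℂ] Lp ℂ 2 gaussian where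
  toFun f := f.2.2.toLp f.1
  map_add' f g := MemLp.toLp_add f.2.2 g.2.2
  map_smul' a f := MemLp.toLp_const_smul a f.2.2

theorem volume_ac_gaussian : (volume : Measure ℂ) ≪ gaussian := by
  refine withDensity_absolutelyContinuous' ?_ ?_
  · exact (by fun_prop : Measurable fun z : ℂ =>
      ENNReal.ofReal (Real.pi⁻¹ * Real.exp (-‖z‖ ^ 2))).aemeasurable
  · refine Eventually.of_forall fun z => ?_
    have : 0 < Real.pi⁻¹ * Real.exp (-‖z‖ ^ 2) := by positivity
    simpa using this

theorem toL2_injective : Function.Injective toL2 := by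
  intro f g h
  have h1 : f.1 =ᵐ[gaussian] g.1 := (MemLp.toLp_eq_toLp_iff f.2.2 g.2.2).1 h
  have h2 : f.1 =ᵐ[volume] g.1 := volume_ac_gaussian.ae_le h1
  exact Subtype.ext ((f.2.1.continuous.ae_eq_iff_eq volume g.2.1.continuous).1 h2)

/-- The norm of `F²` is the norm inherited from `L²(ℂ, dλ)`. -/
instance : NormedAddCommGroup FockSpace :=
  NormedAddCommGroup.induced FockSpace (Lp ℂ 2 gaussian) toL2 toL2_injective

/-- The inner product of `F²` is the one inherited from `L²(ℂ, dλ)`. -/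
instance : InnerProductSpace ℂ FockSpace where
  norm_smul_le a f := by
    change ‖toL2 (a • f)‖ ≤ ‖a‖ * ‖toL2 f‖
    rw [map_smul]
    exact norm_smul_le _ _
  inner f g := inner ℂ (toL2 f) (toL2 g)
  norm_sq_eq_re_inner f := norm_sq_eq_re_inner (𝕜 := ℂ) (toL2 f)
  conj_inner_symm f g := inner_conj_symm (toL2 f) (toL2 g)
  add_left f g h := by
    change inner ℂ (toL2 (f + g)) (toL2 h) = _
    rw [map_add, inner_add_left]
  smul_left f g a := by
    change inner ℂ (toL2 (a • f)) (toL2 g) = _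
    rw [map_smul, inner_smul_left]

/-- The Hilbert space `L²(ℝ) = L²(ℝ, dx)` of complex valued functions. -/
abbrev L2R : Type := Lp ℂ 2 (volume : Measure ℝ)

/-- `B` is the Bargmann transform, as a unitary operator from `L²(ℝ)` onto `F²`:
`Bf(z) = (2/π)^(1/4) ∫ f(x) exp (2xz - x² - z²/2) dx`. The formula determines `B`. -/
def IsBargmannTransform (B : L2R ≃ₗᵢ[ℂ] FockSpace) : Prop :=
  ∀ (f : L2R) (z : ℂ),
    B f z = (((2 / Real.pi) ^ (1 / 4 : ℝ) : ℝ) : ℂ) *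
      ∫ x : ℝ, f x * Complex.exp (2 * x * z - (x : ℂ) ^ 2 - z ^ 2 / 2)

/-- `l` is the value of the principal value integral `(1/π) p.v. ∫ f(t) / (t - x) dt`. -/
def HasHilbertPV (f : ℝ → ℂ) (x : ℝ) (l : ℂ) : Prop :=
  Tendsto (fun ε : ℝ => (1 / (Real.pi : ℂ)) * ∫ t in {t : ℝ | ε < |t - x|}, f t / ((t : ℂ) - x))
    (𝓝[>] 0) (𝓝 l)

/-- `H` is the Hilbert transform, as a bounded operator on `L²(ℝ)`: for every `f`, the principal
value integral exists and equals `Hf(x)` for almost every `x`. This determines `H`. -/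
def IsHilbertTransform (H : L2R →L[ℂ] L2R) : Prop :=
  ∀ f : L2R, ∀ᵐ x : ℝ, HasHilbertPV f x (H f x)

/-- `A(z) = ∫_0^z exp (u²) du`, the integral being taken along the segment from `0` to `z`. -/
def A (z : ℂ) : ℂ := ∫ s in (0 : ℝ)..1, z * Complex.exp ((s * z) ^ 2)

theorem A_zero : A 0 = 0 := by simp [A]

/-- `A` is the antiderivative of `exp (z²)`. -/
theorem hasDerivAt_A (z : ℂ) : HasDerivAt A (Complex.exp (z ^ 2)) z := by
  have hd : Differentiable ℂ fun w : ℂ => Complex.exp (w ^ 2) := by fun_prop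
  obtain ⟨P, hP⟩ := hd.isExactOn_univ
  have hA : ∀ w, A w = P w - P 0 := by
    intro w
    have h : ∀ s ∈ Set.uIcc (0 : ℝ) 1,
        HasDerivAt (fun s : ℝ => P (s * w)) (w * Complex.exp ((s * w) ^ 2)) s := by
      intro s _
      have h1 : HasDerivAt (fun s : ℝ => (s : ℂ) * w) w s := by
        simpa using (Complex.ofRealCLM.hasDerivAt (x := s)).mul_const w
      have h2 := (hP ((s : ℂ) * w) (Set.mem_univ _)).comp s h1
      rwa [mul_comm] at h2
    have h3 := intervalIntegral.integral_eq_sub_of_hasDerivAt h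
      (Continuous.intervalIntegrable (by fun_prop) _ _)
    simpa [A] using h3
  have hAe : A = fun w => P w - P 0 := funext hA
  rw [hAe]
  exact (hP z (Set.mem_univ z)).sub_const (P 0)

end Bargmann

end

/-! Write `c_w` for `coherent w`. Completing the square gives `⟨c_z, c_w⟩ = exp (z w̄)`, so the
Bargmann transform `f ↦ (z ↦ ⟨c_z, f⟩)` carries `c_w` to the reproducing kernel of `F²` at `w`. This
makes it isometric on the span of the `c_w`, which is dense by Fourier uniqueness, and onto by the
Riesz representation theorem. For every bounded `T`, the value of `B T B⁻¹ F` at `z` is `⟨T* c_z,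
B⁻¹ F⟩`; transported to `F²`, this is the integral of `F(w) ⟨c_z, T c_w⟩` against the Gaussian
measure, a product of two `L²` functions (`IsBargmannTransform.integral_kernel`).

It remains to compute `⟨c_z, H c_w⟩` (`IsHilbertTransform.inner_coherentLp`). Fubini and a Gaussian
integral reduce it to `π⁻¹ exp (z w̄)` times the principal value of `exp (-s a - s²/2) / s` with `a
= z - w̄`. Subtracting the odd function `exp (-s²/2) / s` removes the singularity, and `(exp (-s a)
- 1) / s = -a ∫₀¹ exp (-θ s a) dθ` turns the rest into Gaussian integrals in `s`, whose integral
over `θ` is `-2 √π A(a/√2)`.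

The Hilbert transform itself is built without Fourier multipliers, as `-i` times the reflection in a
Hardy space. Pairing with Cauchy kernels shows that the Poisson integral of `H f` is the conjugate
Poisson integral of `f`. At a Lebesgue point of both functions the former tends to `H f`, up to the
factor `π`, and the latter differs from the truncated integral by `o(1)`; hence the principal value
exists almost everywhere (`isHilbertTransform_hilbertOp`). -/

noncomputable section

namespace Bargmann

/-! ### Poisson kernels on the line and approximate identities -/

/-- The Poisson kernel of the upper half-plane, up to the factor `π⁻¹`. -/
def poissonKer (ε s : ℝ) : ℝ := ε / (s ^ 2 + ε ^ 2)

/-- The conjugate Poisson kernel of the upper half-plane, up to the factor `π⁻¹`. -/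
def conjPoissonKer (ε s : ℝ) : ℝ := s / (s ^ 2 + ε ^ 2)

/-- The kernel `1 / s` truncated to `ε < |s|`. -/
def truncKer (ε s : ℝ) : ℝ := if ε < |s| then 1 / s else 0

theorem measurable_poissonKer (ε : ℝ) : Measurable (poissonKer ε) := by
  unfold poissonKer; fun_prop

theorem measurable_conjPoissonKer (ε : ℝ) : Measurable (conjPoissonKer ε) := by
  unfold conjPoissonKer; fun_prop

theorem measurable_truncKer (ε : ℝ) : Measurable (truncKer ε) := by
  unfold truncKer
  exact Measurable.ite (measurableSet_lt measurable_const (by fun_prop)) (by fun_prop)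
    measurable_const

theorem poissonKer_nonneg {ε : ℝ} (hε : 0 < ε) (s : ℝ) : 0 ≤ poissonKer ε s := by
  unfold poissonKer; positivity

theorem poissonKer_eq {ε : ℝ} (hε : 0 < ε) (s : ℝ) :
    poissonKer ε s = ε⁻¹ * (1 + (s / ε) ^ 2)⁻¹ := by
  unfold poissonKer; field_simp; ring

theorem integrable_poissonKer {ε : ℝ} (hε : 0 < ε) : Integrable (poissonKer ε) := by
  have := (integrable_inv_one_add_sq.comp_div hε.ne').const_mul ε⁻¹
  exact this.congr (Eventually.of_forall fun s => (poissonKer_eq hε s).symm)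

theorem integral_poissonKer {ε : ℝ} (hε : 0 < ε) : ∫ s, poissonKer ε s = Real.pi := by
  simp_rw [poissonKer_eq hε]
  rw [integral_const_mul, Measure.integral_comp_div (fun s : ℝ => (1 + s ^ 2)⁻¹) ε,
    integral_univ_inv_one_add_sq, abs_of_pos hε, smul_eq_mul, inv_mul_cancel_left₀ hε.ne']

/-- For `|s| > ε` the difference is `ε² / (s (s² + ε²))`, and one factor `ε / |s|` is below `1`;
otherwise only the conjugate kernel remains and `|s| ≤ ε`. -/
theorem abs_truncKer_sub_conjPoissonKer_le {ε : ℝ} (hε : 0 < ε) (s : ℝ) :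
    |truncKer ε s - conjPoissonKer ε s| ≤ poissonKer ε s := by
  unfold truncKer conjPoissonKer poissonKer
  split_ifs with h
  · have hs : s ≠ 0 := by rintro rfl; simp at h; linarith
    have hs' : 0 < |s| := abs_pos.2 hs
    have e : 1 / s - s / (s ^ 2 + ε ^ 2) = ε ^ 2 / (s * (s ^ 2 + ε ^ 2)) := by
      field_simp; ring
    rw [e, abs_div, abs_mul, abs_of_pos (by positivity : 0 < s ^ 2 + ε ^ 2),
      abs_of_pos (by positivity : 0 < ε ^ 2), div_le_div_iff₀ (by positivity) (by positivity)]
    have : ε * (s ^ 2 + ε ^ 2) * ε ≤ ε * (s ^ 2 + ε ^ 2) * |s| := by gcongr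
    linarith
  · rw [zero_sub, abs_neg, abs_div, abs_of_pos (by positivity : 0 < s ^ 2 + ε ^ 2)]
    gcongr
    exact not_lt.1 h

theorem superlevel_poissonKer {ε t : ℝ} (hε : 0 < ε) (ht : 0 < t) :
    {s | t ≤ poissonKer ε s} = ∅ ∨
      ∃ r, 0 ≤ r ∧ {s | t ≤ poissonKer ε s} = Metric.closedBall 0 r := by
  have key : ∀ s, t ≤ poissonKer ε s ↔ s ^ 2 ≤ ε / t - ε ^ 2 := by
    intro s
    unfold poissonKer
    rw [le_div_iff₀ (by positivity), le_sub_iff_add_le, le_div_iff₀ ht, mul_comm]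
  rcases lt_or_ge (ε / t - ε ^ 2) 0 with h | h
  · left
    ext s
    simp only [Set.mem_ofPred_eq, key, Set.mem_empty_iff_false, iff_false, not_le]
    exact h.trans_le (sq_nonneg s)
  · right
    refine ⟨√(ε / t - ε ^ 2), Real.sqrt_nonneg _, ?_⟩
    ext s
    simp only [Set.mem_ofPred_eq, key, Metric.mem_closedBall, Real.dist_eq, sub_zero]
    rw [Real.le_sqrt (abs_nonneg s) h, sq_abs]

/-- Layer cake: the superlevel sets of the Poisson kernel at positive heights are empty or centred
balls, so comparing `ν` with Lebesgue measure on such balls is enough. -/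
theorem lintegral_poissonKer_le {ν : Measure ℝ} {η : ENNReal} (hη : η ≠ ⊤)
    (hν : ∀ r, 0 ≤ r → ν (Metric.closedBall 0 r) ≤ η * volume (Metric.closedBall (0 : ℝ) r))
    {ε : ℝ} (hε : 0 < ε) :
    ∫⁻ s, ENNReal.ofReal (poissonKer ε s) ∂ν ≤ η * ENNReal.ofReal Real.pi := by
  have h1 : ∫⁻ s, ENNReal.ofReal (poissonKer ε s) = ENNReal.ofReal Real.pi := by
    rw [← integral_poissonKer hε, ofReal_integral_eq_lintegral_ofReal (integrable_poissonKer hε)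
      (Eventually.of_forall (poissonKer_nonneg hε))]
  rw [← h1, lintegral_eq_lintegral_meas_le _ (Eventually.of_forall (poissonKer_nonneg hε))
    (measurable_poissonKer ε).aemeasurable,
    lintegral_eq_lintegral_meas_le _ (Eventually.of_forall (poissonKer_nonneg hε))
    (measurable_poissonKer ε).aemeasurable, ← lintegral_const_mul']
  · refine setLIntegral_mono' measurableSet_Ioi fun t ht => ?_
    rcases superlevel_poissonKer hε ht with h | ⟨r, hr, h⟩
    · simp [h]
    · rw [h]; exact hν r hr
  · exact hη

theorem poissonKer_le_of_le_abs {ε δ s : ℝ} (hε : 0 < ε) (hδ : 0 < δ) (hs : δ ≤ |s|) :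
    poissonKer ε s ≤ ε * ((1 + (δ ^ 2)⁻¹) * (1 + s ^ 2)⁻¹) := by
  have h2 : δ ^ 2 ≤ s ^ 2 := by rw [← sq_abs s]; gcongr
  have h3 : 0 < s ^ 2 := lt_of_lt_of_le (by positivity) h2
  unfold poissonKer
  rw [div_eq_mul_inv]
  gcongr
  calc (s ^ 2 + ε ^ 2)⁻¹ ≤ (s ^ 2)⁻¹ := by gcongr; linarith [sq_nonneg ε]
    _ = (1 + (s ^ 2)⁻¹) * (1 + s ^ 2)⁻¹ := by
      have hs : s ≠ 0 := by rintro rfl; simp at h3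
      field_simp; ring
    _ ≤ _ := by gcongr

theorem poissonKer_le {ε : ℝ} (hε : 0 < ε) (s : ℝ) :
    poissonKer ε s ≤ (ε + ε⁻¹) * (1 + s ^ 2)⁻¹ := by
  unfold poissonKer
  rw [← div_eq_mul_inv, div_le_div_iff₀ (by positivity) (by positivity)]
  have : (ε + ε⁻¹) * (s ^ 2 + ε ^ 2) = ε * (1 + s ^ 2) + ε⁻¹ * s ^ 2 + ε ^ 3 := by
    field_simp; ring
  rw [this]
  have : 0 ≤ ε⁻¹ * s ^ 2 + ε ^ 3 := by positivity
  linarith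

theorem integrable_mul_poissonKer {g : ℝ → ℝ} (hg : Integrable fun s => g s * (1 + s ^ 2)⁻¹)
    {ε : ℝ} (hε : 0 < ε) : Integrable fun s => g s * poissonKer ε s := by
  have h : (fun s => g s * poissonKer ε s) =
      fun s => (poissonKer ε s * (1 + s ^ 2)) * (g s * (1 + s ^ 2)⁻¹) := by
    ext s
    have : 1 + s ^ 2 ≠ 0 := by positivity
    field_simp
  rw [h]
  refine hg.bdd_mul (c := ε + ε⁻¹)
    ((measurable_poissonKer ε).mul (by fun_prop)).aestronglyMeasurable
    (Eventually.of_forall fun s => ?_)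
  rw [Real.norm_of_nonneg (mul_nonneg (poissonKer_nonneg hε s) (by positivity)),
    ← le_div_iff₀ (by positivity), div_eq_mul_inv]
  exact poissonKer_le hε s

theorem tendsto_integral_mul_poissonKer {g : ℝ → ℝ} (g0 : ∀ s, 0 ≤ g s)
    (hg : Integrable fun s => g s * (1 + s ^ 2)⁻¹)
    (hL : Tendsto (fun r => ⨍ s in Metric.closedBall 0 r, g s) (𝓝[>] 0) (𝓝 0)) :
    Tendsto (fun ε => ∫ s, g s * poissonKer ε s) (𝓝[>] 0) (𝓝 0) := by
  have hgl : LocallyIntegrable g := by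
    have h : g = fun s => (1 + s ^ 2) * (g s * (1 + s ^ 2)⁻¹) := by
      ext s
      have : 1 + s ^ 2 ≠ 0 := by positivity
      field_simp
    rw [h]
    exact hg.locallyIntegrable.continuous_smul (g := fun s : ℝ => 1 + s ^ 2) (by fun_prop)
  have hgm : AEMeasurable g := hgl.aestronglyMeasurable.aemeasurable
  -- Near `0` the small averages of `g` bound the integral by `η π`; away from `0` the kernel is
  -- `O(ε)` times the weight `(1 + s²)⁻¹`.
  have main : ∀ η > 0, ∃ C, ∀ ε > 0, ∫ s, g s * poissonKer ε s ≤ η * Real.pi + ε * C := by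
    intro η hη
    obtain ⟨δ, hδ, hball⟩ : ∃ δ > 0, ∀ r ∈ Set.Ioc 0 δ, ∫ s in Metric.closedBall 0 r, g s ≤
        η * volume.real (Metric.closedBall (0 : ℝ) r) := by
      have := (hL.eventually (gt_mem_nhds hη))
      rw [eventually_nhdsWithin_iff, Metric.eventually_nhds_iff] at this
      obtain ⟨δ, hδ, h⟩ := this
      refine ⟨δ / 2, by positivity, fun r hr => ?_⟩
      have h1 := h (y := r) (by rw [Real.dist_eq, sub_zero, abs_of_pos hr.1]; linarith [hr.2]) hr.1
      have hpos : 0 < volume.real (Metric.closedBall (0 : ℝ) r) := by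
        rw [Real.volume_real_closedBall hr.1.le]; linarith [hr.1]
      rw [setAverage_eq, smul_eq_mul, inv_mul_lt_iff₀ hpos] at h1
      linarith
    -- Cutting `g` off outside the `δ`-ball extends the ball estimate to all radii: beyond `δ` the
    -- measure of the ball no longer grows.
    set ν : Measure ℝ := (volume.restrict (Metric.closedBall 0 δ)).withDensity
      (fun s => ENNReal.ofReal (g s)) with hνdef
    have hν : ∀ r, 0 ≤ r →
        ν (Metric.closedBall 0 r) ≤ ENNReal.ofReal η * volume (Metric.closedBall (0 : ℝ) r) := by
      intro r hr
      rw [hνdef, withDensity_apply _ measurableSet_closedBall,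
        Measure.restrict_restrict measurableSet_closedBall]
      have hmin : Metric.closedBall (0 : ℝ) r ∩ Metric.closedBall 0 δ =
          Metric.closedBall 0 (min r δ) := by
        ext s; simp
      rw [hmin]
      rcases hr.eq_or_lt with rfl | hr
      · simp [hδ.le]
      · have hm : 0 < min r δ := lt_min hr hδ
        rw [← ofReal_integral_eq_lintegral_ofReal
          (hgl.integrableOn_isCompact (isCompact_closedBall _ _)) (Eventually.of_forall g0)]
        refine (ENNReal.ofReal_le_ofReal (hball _ ⟨hm, min_le_right _ _⟩)).trans ?_
        rw [ENNReal.ofReal_mul hη.le, ofReal_measureReal measure_closedBall_lt_top.ne]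
        gcongr
        exact min_le_left _ _
    refine ⟨(1 + (δ ^ 2)⁻¹) * ∫ s, g s * (1 + s ^ 2)⁻¹, fun ε hε => ?_⟩
    have hint := integrable_mul_poissonKer hg hε
    rw [← integral_add_compl (measurableSet_closedBall (x := (0 : ℝ)) (ε := δ)) hint]
    refine add_le_add ?_ ?_
    · rw [integral_eq_lintegral_of_nonneg_ae (Eventually.of_forall fun s =>
        mul_nonneg (g0 s) (poissonKer_nonneg hε s)) hint.aestronglyMeasurable.restrict]
      refine ENNReal.toReal_le_of_le_ofReal (by positivity) ?_
      have := lintegral_poissonKer_le ENNReal.ofReal_ne_top hν hε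
      rw [hνdef, lintegral_withDensity_eq_lintegral_mul₀ hgm.restrict.ennreal_ofReal
        (measurable_poissonKer ε).ennreal_ofReal.aemeasurable, ← ENNReal.ofReal_mul hη.le] at this
      refine le_trans (le_of_eq ?_) this
      refine lintegral_congr fun s => ?_
      rw [ENNReal.ofReal_mul (g0 s)]; rfl
    · rw [← integral_const_mul, ← integral_const_mul]
      refine (integral_mono_ae hint.restrict ((hg.const_mul _).const_mul _).restrict ?_).trans
        (setIntegral_le_integral ((hg.const_mul _).const_mul _) (Eventually.of_forall fun s => ?_))
      · filter_upwards [ae_restrict_mem measurableSet_closedBall.compl] with s hs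
        have hs' : δ ≤ |s| := by
          simp at hs; exact hs.le
        calc g s * poissonKer ε s ≤ g s * (ε * ((1 + (δ ^ 2)⁻¹) * (1 + s ^ 2)⁻¹)) :=
              mul_le_mul_of_nonneg_left (poissonKer_le_of_le_abs hε hδ hs') (g0 s)
          _ = _ := by ring
      · have := g0 s
        simp only [Pi.zero_apply]; positivity
  rw [Metric.tendsto_nhds]
  intro e he
  obtain ⟨C, hC⟩ := main (e / (2 * Real.pi)) (by positivity)
  have hlim : Tendsto (fun ε : ℝ => ε * C) (𝓝[>] 0) (𝓝 0) := by
    have : Tendsto (fun ε : ℝ => ε * C) (𝓝 0) (𝓝 (0 * C)) := (continuous_mul_const C).tendsto 0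
    rw [zero_mul] at this
    exact this.mono_left nhdsWithin_le_nhds
  filter_upwards [hlim.eventually (gt_mem_nhds (half_pos he)), self_mem_nhdsWithin] with ε h1 h2
  have h3 := hC ε h2
  have h4 : 0 ≤ ∫ s, g s * poissonKer ε s :=
    integral_nonneg fun s => mul_nonneg (g0 s) (poissonKer_nonneg h2 s)
  rw [Real.dist_eq, sub_zero, abs_of_nonneg h4]
  have : e / (2 * Real.pi) * Real.pi = e / 2 := by field_simp
  linarith

/-! ### Cauchy kernels and their splitting into Poisson kernels -/

theorem memLp_cauchyKer {ζ : ℂ} (hζ : ζ.im ≠ 0) :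
    MemLp (fun t : ℝ => ((t : ℂ) - ζ)⁻¹) 2 := by
  have hne : ∀ t : ℝ, (t : ℂ) - ζ ≠ 0 := fun t h => hζ (by
    have := congrArg Complex.im h
    simpa using this)
  have hc : Continuous fun t : ℝ => ((t : ℂ) - ζ)⁻¹ :=
    Continuous.inv₀ (by fun_prop) hne
  rw [memLp_two_iff_integrable_sq_norm hc.aestronglyMeasurable]
  have h := ((integrable_poissonKer (abs_pos.2 hζ)).comp_sub_right ζ.re).const_mul |ζ.im|⁻¹
  refine h.congr (Eventually.of_forall fun t => ?_)
  have h1 : ‖(t : ℂ) - ζ‖ ^ 2 = (t - ζ.re) ^ 2 + ζ.im ^ 2 := by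
    rw [Complex.sq_norm, Complex.normSq_apply]; simp; ring
  simp only [norm_inv, inv_pow, h1, poissonKer, sq_abs]
  have : |ζ.im| ≠ 0 := abs_ne_zero.2 hζ
  field_simp

theorem inv_sub_mul_I {ε : ℝ} (hε : ε ≠ 0) (s : ℝ) :
    ((s : ℂ) - ε * Complex.I)⁻¹ = conjPoissonKer ε s + poissonKer ε s * Complex.I := by
  have h : ((s ^ 2 + ε ^ 2 : ℝ) : ℂ) ≠ 0 := by exact_mod_cast (by positivity : s ^ 2 + ε ^ 2 ≠ 0)
  rw [inv_eq_iff_eq_inv, eq_comm]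
  apply inv_eq_of_mul_eq_one_left
  unfold conjPoissonKer poissonKer
  push_cast at h ⊢
  field_simp
  ring_nf
  rw [Complex.I_sq]; ring

theorem memLp_poissonKer {ε : ℝ} (hε : ε ≠ 0) : MemLp (fun s => (poissonKer ε s : ℂ)) 2 := by
  have h := (memLp_cauchyKer (ζ := ε * Complex.I) (by simpa)).im.ofReal (K := ℂ)
  refine h.ae_eq (Eventually.of_forall fun s => ?_)
  simp [inv_sub_mul_I hε]

theorem memLp_conjPoissonKer {ε : ℝ} (hε : ε ≠ 0) :
    MemLp (fun s => (conjPoissonKer ε s : ℂ)) 2 := by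
  have h := (memLp_cauchyKer (ζ := ε * Complex.I) (by simpa)).re.ofReal (K := ℂ)
  refine h.ae_eq (Eventually.of_forall fun s => ?_)
  simp [inv_sub_mul_I hε]

theorem memLp_inv_one_add_sq : MemLp (fun s : ℝ => (1 + s ^ 2)⁻¹) 2 := by
  have h := memLp_poissonKer one_ne_zero
  refine h.re.ae_eq (Eventually.of_forall fun s => ?_)
  change (poissonKer 1 s : ℂ).re = _
  rw [Complex.ofReal_re, poissonKer]
  simp [add_comm]

theorem memLp_comp_add {f : ℝ → ℂ} (hf : MemLp f 2) (x : ℝ) : MemLp (fun s => f (x + s)) 2 :=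
  hf.comp_measurePreserving (measurePreserving_add_left volume x)

/-- The Cauchy transform of `f` at `x + i ε`, in terms of the two Poisson kernels. -/
theorem integral_mul_cauchyKer {f : ℝ → ℂ} (hf : MemLp f 2) (x : ℝ) {ε : ℝ} (hε : ε ≠ 0) :
    ∫ t, f t * ((t : ℂ) - (x + ε * Complex.I))⁻¹ =
      (∫ s, f (x + s) * conjPoissonKer ε s) + (∫ s, f (x + s) * poissonKer ε s) * Complex.I := by
  have hx := memLp_comp_add hf x
  have h1 : Integrable fun s => f (x + s) * (conjPoissonKer ε s : ℂ) :=
    hx.integrable_mul (memLp_conjPoissonKer hε)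
  have h2 : Integrable fun s => f (x + s) * (poissonKer ε s : ℂ) * Complex.I :=
    (hx.integrable_mul (memLp_poissonKer hε)).mul_const Complex.I
  rw [← integral_add_left_eq_self _ x, ← integral_mul_const, ← integral_add h1 h2]
  refine integral_congr_ae (Eventually.of_forall fun s => ?_)
  have : ((x + s : ℝ) : ℂ) - (x + ε * Complex.I) = s - ε * Complex.I := by push_cast; ring
  simp only [this, inv_sub_mul_I hε]
  ring

theorem conjPoissonKer_neg_left (ε s : ℝ) : conjPoissonKer (-ε) s = conjPoissonKer ε s := by
  simp [conjPoissonKer]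

theorem poissonKer_neg_left (ε s : ℝ) : poissonKer (-ε) s = -poissonKer ε s := by
  simp [poissonKer, neg_div]

theorem integral_odd_eq_zero {E : Type*} [NormedAddCommGroup E] [NormedSpace ℝ E] {u : ℝ → E}
    (hu : ∀ s, u (-s) = -u s) : ∫ s, u s = 0 := by
  have h := integral_neg_eq_self u volume
  simp_rw [hu, integral_neg] at h
  have h2 : (2 : ℝ) • ∫ s, u s = 0 := by
    rw [two_smul]
    nth_rewrite 1 [← h]
    exact neg_add_cancel _
  exact (smul_eq_zero.1 h2).resolve_left two_ne_zero

theorem setIntegral_div_sub_eq (f : ℝ → ℂ) (x ε : ℝ) :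
    ∫ t in {t : ℝ | ε < |t - x|}, f t / ((t : ℂ) - x) = ∫ s, f (x + s) * truncKer ε s := by
  rw [← integral_indicator (measurableSet_lt measurable_const (by fun_prop)),
    ← integral_add_left_eq_self _ x]
  refine integral_congr_ae (Eventually.of_forall fun s => ?_)
  by_cases h : ε < |s|
  · simp [truncKer, h, div_eq_mul_inv]
  · simp [truncKer, h]

/-! ### Boundary behaviour at Lebesgue points -/

/-- `x` is a Lebesgue point of `f`. -/
def IsLebesguePoint (f : ℝ → ℂ) (x : ℝ) : Prop :=
  Tendsto (fun r => ⨍ t in Metric.closedBall x r, ‖f t - f x‖) (𝓝[>] 0) (𝓝 0)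

theorem ae_isLebesguePoint {f : ℝ → ℂ} (hf : LocallyIntegrable f) :
    ∀ᵐ x, IsLebesguePoint f x := by
  filter_upwards [IsUnifLocDoublingMeasure.ae_tendsto_average_norm_sub volume hf 1] with x hx
  refine hx (fun _ => x) id tendsto_id ?_
  filter_upwards [self_mem_nhdsWithin] with r hr
  have : (0 : ℝ) < r := hr
  simp [this.le]

/-- The constant `f x` is not in `L²`, but the weight lies in both `L²` and `L¹`, so it serves both
terms. -/
theorem integrable_sub_mul_inv_one_add_sq {f : ℝ → ℂ} (hf : MemLp f 2) (x : ℝ) :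
    Integrable fun s => ‖f (x + s) - f x‖ * (1 + s ^ 2)⁻¹ := by
  have h1 : Integrable fun s => f (x + s) * ((1 + s ^ 2)⁻¹ : ℝ) :=
    (memLp_comp_add hf x).integrable_mul memLp_inv_one_add_sq.ofReal
  have h2 : Integrable fun s : ℝ => f x * ((1 + s ^ 2)⁻¹ : ℝ) :=
    integrable_inv_one_add_sq.ofReal.const_mul _
  refine (h1.sub h2).norm.congr (Eventually.of_forall fun s => ?_)
  have : (0 : ℝ) < 1 + s ^ 2 := by positivity
  simp only [Pi.sub_apply]
  rw [← sub_mul, norm_mul, Complex.norm_real, Real.norm_of_nonneg (inv_nonneg.2 this.le)]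

theorem tendsto_integral_norm_sub_mul_poissonKer {f : ℝ → ℂ} (hf : MemLp f 2)
    {x : ℝ} (hx : IsLebesguePoint f x) :
    Tendsto (fun ε => ∫ s, ‖f (x + s) - f x‖ * poissonKer ε s) (𝓝[>] 0) (𝓝 0) := by
  refine tendsto_integral_mul_poissonKer (fun s => norm_nonneg _)
    (integrable_sub_mul_inv_one_add_sq hf x) ?_
  refine hx.congr' ?_
  filter_upwards [self_mem_nhdsWithin] with r hr
  rw [setAverage_eq, setAverage_eq]
  congr 1
  · have : (0 : ℝ) ≤ r := le_of_lt hr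
    rw [Real.volume_real_closedBall this, Real.volume_real_closedBall this]
  · rw [← integral_indicator measurableSet_closedBall, ← integral_indicator
      measurableSet_closedBall, ← integral_add_left_eq_self _ x]
    congr 1
    ext s
    simp only [Set.indicator, Metric.mem_closedBall, dist_self_add_left, dist_zero_right]

theorem tendsto_integral_mul_poissonKer_of_isLebesguePoint {f : ℝ → ℂ} (hf : MemLp f 2)
    {x : ℝ} (hx : IsLebesguePoint f x) :
    Tendsto (fun ε => ∫ s, f (x + s) * poissonKer ε s) (𝓝[>] 0) (𝓝 (Real.pi * f x)) := by
  rw [tendsto_iff_norm_sub_tendsto_zero]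
  refine squeeze_zero' (Eventually.of_forall fun _ => norm_nonneg _) ?_
    (tendsto_integral_norm_sub_mul_poissonKer hf hx)
  filter_upwards [self_mem_nhdsWithin] with ε (hε : 0 < ε)
  have h1 : Integrable fun s => f (x + s) * (poissonKer ε s : ℂ) :=
    (memLp_comp_add hf x).integrable_mul (memLp_poissonKer hε.ne')
  have h2 : Integrable fun s => f x * (poissonKer ε s : ℂ) :=
    (integrable_poissonKer hε).ofReal.const_mul _
  have h3 : (Real.pi : ℂ) * f x = ∫ s, f x * (poissonKer ε s : ℂ) := by
    rw [integral_const_mul, integral_complex_ofReal, integral_poissonKer hε, mul_comm]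
  rw [h3, ← integral_sub h1 h2]
  refine (norm_integral_le_integral_norm _).trans (le_of_eq ?_)
  refine integral_congr_ae (Eventually.of_forall fun s => ?_)
  simp only [← sub_mul, norm_mul, Complex.norm_real,
    Real.norm_of_nonneg (poissonKer_nonneg hε s)]

theorem tendsto_integral_trunc_sub_conjPoisson {f : ℝ → ℂ} (hf : MemLp f 2)
    {x : ℝ} (hx : IsLebesguePoint f x) :
    Tendsto (fun ε => (∫ s, f (x + s) * truncKer ε s) - ∫ s, f (x + s) * conjPoissonKer ε s)
      (𝓝[>] 0) (𝓝 0) := by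
  rw [tendsto_zero_iff_norm_tendsto_zero]
  refine squeeze_zero' (Eventually.of_forall fun _ => norm_nonneg _) ?_
    (tendsto_integral_norm_sub_mul_poissonKer hf hx)
  filter_upwards [self_mem_nhdsWithin] with ε (hε : 0 < ε)
  set κ : ℝ → ℝ := fun s => truncKer ε s - conjPoissonKer ε s with hκ
  have hκm : Measurable κ := (measurable_truncKer ε).sub (measurable_conjPoissonKer ε)
  have hκle : ∀ s, |κ s| ≤ poissonKer ε s := abs_truncKer_sub_conjPoissonKer_le hε
  have hfκ : Integrable fun s => f (x + s) * (κ s : ℂ) := by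
    refine ((memLp_comp_add hf x).integrable_mul (memLp_poissonKer hε.ne')).mono
      ((memLp_comp_add hf x).1.mul (by fun_prop)) (Eventually.of_forall fun s => ?_)
    simp only [Pi.mul_apply, norm_mul, Complex.norm_real, Real.norm_eq_abs]
    exact mul_le_mul_of_nonneg_left ((hκle s).trans (le_abs_self _)) (norm_nonneg _)
  have hcκ : Integrable fun s => f x * (κ s : ℂ) := by
    refine Integrable.const_mul (Integrable.ofReal ?_) _
    exact (integrable_poissonKer hε).mono hκm.aestronglyMeasurable
      (Eventually.of_forall fun s => (hκle s).trans (le_abs_self _))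
  have h1 : Integrable fun s => f (x + s) * (conjPoissonKer ε s : ℂ) :=
    (memLp_comp_add hf x).integrable_mul (memLp_conjPoissonKer hε.ne')
  have h2 : Integrable fun s => f (x + s) * (truncKer ε s : ℂ) := by
    refine (hfκ.add h1).congr (Eventually.of_forall fun s => ?_)
    simp [hκ]; ring
  -- `κ` is odd, so it annihilates constants; hence `f (x + s)` may be replaced by `f (x + s) - f
  -- x`, and `|κ|` is below the Poisson kernel.
  have h3 : ∫ s, f x * (κ s : ℂ) = 0 := by
    refine integral_odd_eq_zero fun s => ?_
    have : κ (-s) = -κ s := by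
      simp only [hκ, truncKer, conjPoissonKer, abs_neg, neg_sq]
      split_ifs
      · ring
      · ring
    rw [this]; push_cast; ring
  have h4 : (∫ s, f (x + s) * truncKer ε s) - ∫ s, f (x + s) * conjPoissonKer ε s =
      ∫ s, (f (x + s) * (κ s : ℂ) - f x * (κ s : ℂ)) := by
    rw [integral_sub hfκ hcκ, h3, sub_zero]
    refine (integral_sub h2 h1).symm.trans ?_
    congr 1
    ext s
    simp [hκ]; ring
  rw [h4]
  refine (norm_integral_le_integral_norm _).trans ?_
  refine integral_mono_of_nonneg (Eventually.of_forall fun _ => norm_nonneg _)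
    (integrable_mul_poissonKer (integrable_sub_mul_inv_one_add_sq hf x) hε)
    (Eventually.of_forall fun s => ?_)
  simp only [← sub_mul, norm_mul, Complex.norm_real, Real.norm_eq_abs]
  gcongr
  exact hκle s

/-! ### The Hilbert transform as a reflection in a Hardy space -/

/-- The Cauchy kernel `t ↦ 1 / (t - ζ)`, as an element of `L²(ℝ)`. -/
def cauchyLp (ζ : ℂ) (hζ : ζ.im ≠ 0) : L2R := (memLp_cauchyKer hζ).toLp _

theorem inner_cauchyLp (ζ : ℂ) (hζ : ζ.im ≠ 0) (f : L2R) :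
    inner ℂ (cauchyLp ζ hζ) f = ∫ t, f t * ((t : ℂ) - (starRingEnd ℂ) ζ)⁻¹ := by
  rw [L2.inner_def]
  refine integral_congr_ae ?_
  filter_upwards [(memLp_cauchyKer hζ).coeFn_toLp] with t ht
  rw [cauchyLp, ht, RCLike.inner_apply]
  simp

/-- Numerator and denominator both have positive imaginary part, so the quotient is not a real
number `≤ 0`. This allows the principal logarithm as an antiderivative along the whole line. -/
theorem sub_mem_slitPlane_div {a b : ℂ} (ha : a.im < 0) (hb : b.im < 0) (x : ℝ) :
    ((x : ℂ) - a) / (x - b) ∈ Complex.slitPlane := by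
  have hb0 : (x : ℂ) - b ≠ 0 := fun h => by
    have := congrArg Complex.im h
    simp at this; linarith
  rw [Complex.mem_slitPlane_iff_not_le_zero]
  intro h
  obtain ⟨hre, him⟩ := Complex.le_def.1 h
  set q := ((x : ℂ) - a) / (x - b)
  have h1 : (x : ℂ) - a = q * (x - b) := (div_mul_cancel₀ _ hb0).symm
  have h2 := congrArg Complex.im h1
  simp at h2 him hre
  rw [him] at h2
  nlinarith

theorem tendsto_sub_div_sub {l : Filter ℝ} (hl : Tendsto (fun x : ℝ => |x|) l atTop) (a b : ℂ) :
    Tendsto (fun x : ℝ => ((x : ℂ) - a) / (x - b)) l (𝓝 1) := by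
  have hinv : Tendsto (fun x : ℝ => ((x : ℂ))⁻¹) l (𝓝 0) := by
    rw [tendsto_zero_iff_norm_tendsto_zero]
    simpa [Function.comp_def] using tendsto_inv_atTop_zero.comp hl
  have h : Tendsto (fun x : ℝ => (1 - a * (x : ℂ)⁻¹) / (1 - b * (x : ℂ)⁻¹)) l
      (𝓝 ((1 - a * 0) / (1 - b * 0))) :=
    (tendsto_const_nhds.sub (hinv.const_mul a)).div (tendsto_const_nhds.sub (hinv.const_mul b))
      (by simp)
  simp only [mul_zero, sub_zero, div_one] at h
  refine h.congr' ?_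
  filter_upwards [hl.eventually_gt_atTop 0] with x hx
  have hx : (x : ℂ) ≠ 0 := by simpa using hx
  rw [← mul_div_mul_left _ _ hx]
  congr 1 <;> field_simp

/-- Both poles lie on the same side of the line. Instead of closing a contour, use the
antiderivative `(a - b)⁻¹ log ((t - a) / (t - b))`, or `-(t - a)⁻¹` when `a = b`; it vanishes at
both ends. -/
theorem integral_cauchyKer_mul_eq_zero {a b : ℂ} (ha : a.im < 0) (hb : b.im < 0) :
    ∫ t : ℝ, ((t : ℂ) - a)⁻¹ * ((t : ℂ) - b)⁻¹ = 0 := by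
  have ne : ∀ {c : ℂ}, c.im < 0 → ∀ t : ℝ, (t : ℂ) - c ≠ 0 := fun {c} hc t h => by
    have := congrArg Complex.im h
    simp at this; linarith
  have hint : Integrable fun t : ℝ => ((t : ℂ) - a)⁻¹ * ((t : ℂ) - b)⁻¹ :=
    (memLp_cauchyKer ha.ne).integrable_mul (memLp_cauchyKer hb.ne)
  have hder : ∀ (c : ℂ) (t : ℝ), HasDerivAt (fun t : ℝ => (t : ℂ) - c) 1 t := fun c t =>
    (Complex.ofRealCLM.hasDerivAt (x := t)).sub_const c
  have habs : ∀ {l : Filter ℝ}, (l = atTop ∨ l = atBot) → Tendsto (fun x : ℝ => |x|) l atTop := by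
    rintro l (rfl | rfl)
    · exact tendsto_abs_atTop_atTop
    · exact tendsto_abs_atBot_atTop
  by_cases hab : a = b
  · subst hab
    have hlim : ∀ {l : Filter ℝ}, (l = atTop ∨ l = atBot) →
        Tendsto (fun t : ℝ => -((t : ℂ) - a)⁻¹) l (𝓝 0) := by
      intro l hl
      have hinv : Tendsto (fun x : ℝ => ((x : ℂ))⁻¹) l (𝓝 0) := by
        rw [tendsto_zero_iff_norm_tendsto_zero]
        simpa [Function.comp_def] using tendsto_inv_atTop_zero.comp (habs hl)
      have h := (tendsto_sub_div_sub (habs hl) 0 a).mul hinv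
      rw [one_mul] at h
      have h' := h.neg
      rw [neg_zero] at h'
      refine h'.congr' ?_
      filter_upwards [(habs hl).eventually_gt_atTop 0] with x hx
      have hx : (x : ℂ) ≠ 0 := by simpa using hx
      have := ne ha x
      field_simp
      ring
    have := integral_of_hasDerivAt_of_tendsto (f := fun t : ℝ => -((t : ℂ) - a)⁻¹) (fun t => by
      have := ((hder a t).fun_inv (ne ha t)).neg
      refine this.congr_deriv ?_
      have := ne ha t
      field_simp) hint (hlim (Or.inr rfl)) (hlim (Or.inl rfl))
    simpa using this
  · have hab' : a - b ≠ 0 := sub_ne_zero.2 hab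
    have hlim : ∀ {l : Filter ℝ}, (l = atTop ∨ l = atBot) →
        Tendsto (fun t : ℝ => (a - b)⁻¹ * Complex.log (((t : ℂ) - a) / (t - b))) l (𝓝 0) := by
      intro l hl
      have h := ((tendsto_sub_div_sub (habs hl) a b).clog (by simp)).const_mul (a - b)⁻¹
      simpa using h
    have := integral_of_hasDerivAt_of_tendsto
      (f := fun t : ℝ => (a - b)⁻¹ * Complex.log (((t : ℂ) - a) / (t - b))) (fun t => by
      have h1 := (((hder a t).fun_div (hder b t) (ne hb t)).clog_real
        (sub_mem_slitPlane_div ha hb t)).const_mul (a - b)⁻¹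
      refine h1.congr_deriv ?_
      have := ne ha t
      have := ne hb t
      field_simp
      ring) hint (hlim (Or.inr rfl)) (hlim (Or.inl rfl))
    simpa using this

/-- The Hardy space of the lower half-plane: the closed span of the Cauchy kernels with pole in
the upper half-plane. -/
def hardySubspace : Submodule ℂ L2R :=
  (Submodule.span ℂ {k | ∃ ζ : ℂ, ∃ h : 0 < ζ.im, k = cauchyLp ζ h.ne'}).topologicalClosure

instance : CompleteSpace hardySubspace :=
  (Submodule.isClosed_topologicalClosure _).completeSpace_coe

theorem cauchyLp_mem_hardySubspace {ζ : ℂ} (h : 0 < ζ.im) :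
    cauchyLp ζ h.ne' ∈ hardySubspace :=
  Submodule.le_topologicalClosure _ (Submodule.subset_span ⟨ζ, h, rfl⟩)

theorem cauchyLp_mem_hardySubspace_orthogonal {ζ : ℂ} (h : ζ.im < 0) :
    cauchyLp ζ h.ne ∈ hardySubspaceᗮ := by
  rw [hardySubspace, Submodule.orthogonal_closure, Submodule.mem_orthogonal]
  intro u hu
  induction hu using Submodule.span_induction with
  | mem u hu =>
    obtain ⟨ξ, hξ, rfl⟩ := hu
    rw [inner_cauchyLp, ← integral_cauchyKer_mul_eq_zero h (b := (starRingEnd ℂ) ξ) (by simpa)]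
    refine integral_congr_ae ?_
    filter_upwards [(memLp_cauchyKer h.ne).coeFn_toLp] with t ht
    rw [cauchyLp, ht]
  | zero => simp
  | add u v _ _ hu hv => rw [inner_add_left, hu, hv, add_zero]
  | smul a u _ hu => rw [inner_smul_left, hu, mul_zero]

/-- The Hilbert transform: multiplication by `-i` on the span of the Cauchy kernels with pole in
the upper half-plane, and by `i` on its orthogonal complement. -/
def hilbertOp : L2R →L[ℂ] L2R :=
  (-Complex.I) • (hardySubspace.reflection.toContinuousLinearEquiv : L2R →L[ℂ] L2R)

theorem hilbertOp_apply (f : L2R) : hilbertOp f = -Complex.I • hardySubspace.reflection f := rfl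

theorem inner_cauchyLp_hilbertOp_of_pos {ζ : ℂ} (h : 0 < ζ.im) (f : L2R) :
    inner ℂ (cauchyLp ζ h.ne') (hilbertOp f) =
      -Complex.I * inner ℂ (cauchyLp ζ h.ne') f := by
  rw [hilbertOp_apply, inner_smul_right, ← LinearIsometryEquiv.inner_map_map
    hardySubspace.reflection, Submodule.reflection_reflection,
    Submodule.reflection_mem_subspace_eq_self (cauchyLp_mem_hardySubspace h)]

theorem inner_cauchyLp_hilbertOp_of_neg {ζ : ℂ} (h : ζ.im < 0) (f : L2R) :
    inner ℂ (cauchyLp ζ h.ne) (hilbertOp f) =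
      Complex.I * inner ℂ (cauchyLp ζ h.ne) f := by
  rw [hilbertOp_apply, inner_smul_right, ← LinearIsometryEquiv.inner_map_map
    hardySubspace.reflection, Submodule.reflection_reflection,
    Submodule.reflection_mem_subspace_orthogonalComplement_eq_neg
      (cauchyLp_mem_hardySubspace_orthogonal h), inner_neg_left]
  ring

/-- Pairing with the Cauchy kernels at `x + iε` and `x - iε`, where the operator acts as `-i` and
`i`, gives two equations between Poisson and conjugate Poisson integrals; half their difference is
the claim. -/
theorem integral_hilbertOp_mul_poissonKer (f : L2R) (x : ℝ) {ε : ℝ} (hε : 0 < ε) :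
    ∫ s, hilbertOp f (x + s) * poissonKer ε s = ∫ s, f (x + s) * conjPoissonKer ε s := by
  have h1 := inner_cauchyLp_hilbertOp_of_pos (ζ := x + ε * Complex.I) (by simpa) f
  have h2 := inner_cauchyLp_hilbertOp_of_neg (ζ := x + (-ε : ℝ) * Complex.I) (by simpa) f
  simp only [inner_cauchyLp] at h1 h2
  have e1 : (starRingEnd ℂ) (x + ε * Complex.I) = x + (-ε : ℝ) * Complex.I := by simp
  have e2 : (starRingEnd ℂ) (x + (-ε : ℝ) * Complex.I) = x + ε * Complex.I := by simp
  rw [e1, integral_mul_cauchyKer (Lp.memLp _) x (neg_ne_zero.2 hε.ne'),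
    integral_mul_cauchyKer (Lp.memLp _) x (neg_ne_zero.2 hε.ne')] at h1
  rw [e2, integral_mul_cauchyKer (Lp.memLp _) x hε.ne',
    integral_mul_cauchyKer (Lp.memLp _) x hε.ne'] at h2
  simp only [conjPoissonKer_neg_left, poissonKer_neg_left, Complex.ofReal_neg, mul_neg,
    integral_neg] at h1
  have := Complex.I_sq
  linear_combination (Complex.I / 2) * h1 - (Complex.I / 2) * h2 +
    ((∫ s, hilbertOp f (x + s) * poissonKer ε s) -
    ∫ s, f (x + s) * conjPoissonKer ε s) * this

theorem isHilbertTransform_hilbertOp : IsHilbertTransform hilbertOp := by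
  intro f
  have hloc : ∀ g : L2R, LocallyIntegrable g := fun g =>
    (Lp.memLp g).locallyIntegrable (by norm_num)
  filter_upwards [ae_isLebesguePoint (hloc f), ae_isLebesguePoint (hloc (hilbertOp f))]
    with x h1 h2
  have t1 := tendsto_integral_mul_poissonKer_of_isLebesguePoint (Lp.memLp _) h2
  have t2 := tendsto_integral_trunc_sub_conjPoisson (Lp.memLp _) h1
  have t3 := (t2.add t1).const_mul (1 / (Real.pi : ℂ))
  have hπ : (Real.pi : ℂ) ≠ 0 := by exact_mod_cast Real.pi_ne_zero
  rw [zero_add, ← mul_assoc, one_div_mul_cancel hπ, one_mul] at t3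
  refine t3.congr' ?_
  filter_upwards [self_mem_nhdsWithin] with ε (hε : 0 < ε)
  rw [integral_hilbertOp_mul_poissonKer f x hε, sub_add_cancel, setIntegral_div_sub_eq]

/-! ### The Gaussian measure and the reproducing kernel of the Fock space -/

/-- The density of `gaussian` with respect to area measure. -/
def gaussDensity (w : ℂ) : ℝ := Real.pi⁻¹ * Real.exp (-‖w‖ ^ 2)

theorem gaussDensity_nonneg (w : ℂ) : 0 ≤ gaussDensity w := by unfold gaussDensity; positivity

theorem measurable_ofReal_gaussDensity :
    Measurable fun w : ℂ => ENNReal.ofReal (gaussDensity w) := by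
  unfold gaussDensity; fun_prop

theorem integrable_gaussian_iff {g : ℂ → ℂ} :
    Integrable g gaussian ↔ Integrable fun w => (gaussDensity w : ℂ) * g w := by
  have := integrable_withDensity_iff_integrable_smul' (μ := (volume : Measure ℂ)) (g := g)
    measurable_ofReal_gaussDensity (Eventually.of_forall fun _ => ENNReal.ofReal_lt_top)
  simp only [ENNReal.toReal_ofReal (gaussDensity_nonneg _), Complex.real_smul] at this
  exact this

theorem integral_gaussian_eq (g : ℂ → ℂ) :
    ∫ w, g w ∂gaussian = ∫ w, (gaussDensity w : ℂ) * g w := by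
  have := integral_withDensity_eq_integral_toReal_smul (μ := (volume : Measure ℂ))
    measurable_ofReal_gaussDensity (Eventually.of_forall fun _ => ENNReal.ofReal_lt_top) g
  simp only [ENNReal.toReal_ofReal (gaussDensity_nonneg _), Complex.real_smul] at this
  exact this

theorem integral_gaussDensity : ∫ w, gaussDensity w = 1 := by
  unfold gaussDensity
  have := GaussianFourier.integral_rexp_neg_mul_sq_norm (V := ℂ) one_pos
  rw [Complex.finrank_real_complex] at this
  simp only [neg_mul, one_mul, div_one, Nat.cast_ofNat, div_self (two_ne_zero (α := ℝ)),
    Real.rpow_one] at this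
  rw [integral_const_mul, this, inv_mul_cancel₀ Real.pi_ne_zero]

theorem integrable_gaussDensity : Integrable gaussDensity :=
  .of_integral_ne_zero (by rw [integral_gaussDensity]; exact one_ne_zero)

instance : IsProbabilityMeasure gaussian where
  measure_univ := by
    rw [gaussian, withDensity_apply _ MeasurableSet.univ, Measure.restrict_univ]
    change ∫⁻ w, ENNReal.ofReal (gaussDensity w) = 1
    rw [← ofReal_integral_eq_lintegral_ofReal integrable_gaussDensity
      (Eventually.of_forall gaussDensity_nonneg), integral_gaussDensity, ENNReal.ofReal_one]

theorem integral_gaussian_comp_mul {g : ℂ → ℂ} {a : ℂ} (ha : ‖a‖ = 1) :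
    ∫ w, g (a * w) ∂gaussian = ∫ w, g w ∂gaussian := by
  have h := (rotation ⟨a, mem_sphere_zero_iff_norm.2 ha⟩).measurePreserving.integral_comp'
    (f := (rotation ⟨a, mem_sphere_zero_iff_norm.2 ha⟩).toHomeomorph.toMeasurableEquiv)
    (fun w => (gaussDensity w : ℂ) * g w)
  rw [integral_gaussian_eq, integral_gaussian_eq, ← h]
  refine integral_congr_ae (Eventually.of_forall fun w => ?_)
  change _ = (gaussDensity (a * w) : ℂ) * g (a * w)
  simp [gaussDensity, ha]

theorem integrable_gaussian_comp_mul {g : ℂ → ℂ} (hg : Integrable g gaussian) {a : ℂ}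
    (ha : ‖a‖ = 1) : Integrable (fun w => g (a * w)) gaussian := by
  rw [integrable_gaussian_iff] at hg ⊢
  have h := (rotation
    ⟨a, mem_sphere_zero_iff_norm.2 ha⟩).measurePreserving.integrable_comp_of_integrable hg
  refine h.congr (Eventually.of_forall fun w => ?_)
  change (gaussDensity (a * w) : ℂ) * g (a * w) = _
  simp [gaussDensity, ha]

/-- The mean value property of entire functions for the Gaussian measure. -/
theorem integral_gaussian_of_differentiable {g : ℂ → ℂ} (hd : Differentiable ℂ g)
    (hg : Integrable g gaussian) : ∫ w, g w ∂gaussian = g 0 := by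
  have hone : ∀ θ : ℝ, ‖circleMap 0 1 θ‖ = 1 := fun θ => by simp
  -- The average of `g` over the circle through `w` about `0` is `g 0`. Integrating this over `w`
  -- and exchanging integrals, rotation invariance gives the integral of `g` itself.
  have hmv : ∀ w, (2 * Real.pi)⁻¹ • ∫ θ in (0)..2 * Real.pi, g (circleMap 0 1 θ * w) = g 0 := by
    intro w
    have hd' : Differentiable ℂ fun ζ => g (ζ * w) := hd.comp (by fun_prop)
    have := (hd'.diffContOnCl (s := Metric.ball 0 |1|)).circleAverage
    simpa [Real.circleAverage] using this
  have hint : Integrable (Function.uncurry fun (θ : ℝ) (w : ℂ) => g (circleMap 0 1 θ * w))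
      ((volume.restrict (Set.uIoc 0 (2 * Real.pi))).prod gaussian) := by
    have hc : Continuous (Function.uncurry fun (θ : ℝ) (w : ℂ) => g (circleMap 0 1 θ * w)) := by
      have : Continuous fun p : ℝ × ℂ => circleMap 0 1 p.1 * p.2 :=
        ((continuous_circleMap 0 1).comp continuous_fst).mul continuous_snd
      exact hd.continuous.comp this
    rw [integrable_prod_iff hc.aestronglyMeasurable]
    have hθ : ∀ θ : ℝ, Integrable (fun w => g (circleMap 0 1 θ * w)) gaussian :=
      fun θ => integrable_gaussian_comp_mul hg (hone θ)
    simp only [Function.uncurry_apply_pair]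
    refine ⟨Eventually.of_forall hθ, ?_⟩
    have : ∀ θ : ℝ, ∫ w, ‖g (circleMap 0 1 θ * w)‖ ∂gaussian = ∫ w, ‖g w‖ ∂gaussian := by
      intro θ
      have := integral_gaussian_comp_mul (g := fun w => (‖g w‖ : ℂ)) (hone θ)
      rw [integral_complex_ofReal, integral_complex_ofReal] at this
      exact_mod_cast this
    simp only [this]
    exact intervalIntegrable_iff.1 intervalIntegrable_const
  have hsw := intervalIntegral_integral_swap hint
  have hrot : ∀ θ : ℝ, ∫ w, g (circleMap 0 1 θ * w) ∂gaussian = ∫ w, g w ∂gaussian :=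
    fun θ => integral_gaussian_comp_mul (hone θ)
  rw [intervalIntegral.integral_congr (fun θ _ => hrot θ)] at hsw
  have h2 : ∫ w, g 0 ∂gaussian = ∫ w, g w ∂gaussian := by
    rw [← integral_congr_ae (Eventually.of_forall hmv), integral_smul, ← hsw,
      intervalIntegral.integral_const, smul_smul, sub_zero, inv_mul_cancel₀ (by positivity),
      one_smul]
  rw [← h2]
  simp

/-- From `|w - z|² + (w - z) z̄ = |w|² - z w̄`: translation by `z` turns the reproducing formula at
`z` into the mean value property at `0`. -/
theorem gaussDensity_mul_exp (z w : ℂ) :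
    (gaussDensity (w - z) : ℂ) * Complex.exp (-((w - z) * (starRingEnd ℂ) z)) =
      gaussDensity w * Complex.exp (z * (starRingEnd ℂ) w) := by
  have h : ∀ u : ℂ, (‖u‖ : ℂ) ^ 2 = u * (starRingEnd ℂ) u := fun u => by
    rw [Complex.mul_conj']
  simp only [gaussDensity, Complex.ofReal_mul, Complex.ofReal_exp, Complex.ofReal_neg,
    Complex.ofReal_pow, h, mul_assoc, ← Complex.exp_add, map_sub]
  ring_nf

theorem memLp_exp_mul_conj (z : ℂ) :
    MemLp (fun w => Complex.exp (w * (starRingEnd ℂ) z)) 2 gaussian := by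
  rw [memLp_two_iff_integrable_sq_norm (by fun_prop)]
  refine (integrable_withDensity_iff_integrable_smul' measurable_ofReal_gaussDensity
      (Eventually.of_forall fun _ => ENNReal.ofReal_lt_top)).2 ?_
  have h := (integrable_gaussDensity.comp_sub_right z).const_mul (Real.exp (‖z‖ ^ 2))
  refine h.congr (Eventually.of_forall fun w => ?_)
  simp only [smul_eq_mul]
  rw [ENNReal.toReal_ofReal (gaussDensity_nonneg w), Complex.norm_exp, ← Real.exp_nat_mul,
    gaussDensity, gaussDensity, mul_left_comm, mul_assoc, ← Real.exp_add, ← Real.exp_add]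
  congr 2
  simp only [Complex.sq_norm, Complex.normSq_apply, Complex.sub_re, Complex.sub_im, Complex.mul_re,
    Complex.conj_re, Complex.conj_im]
  push_cast
  ring

/-- The reproducing kernel `w ↦ exp (w z̄)` of the Fock space. -/
def fockKer (z : ℂ) : FockSpace :=
  ⟨fun w => Complex.exp (w * (starRingEnd ℂ) z), by fun_prop, memLp_exp_mul_conj z⟩

theorem fockKer_apply (z w : ℂ) : fockKer z w = Complex.exp (w * (starRingEnd ℂ) z) := rfl

theorem FockSpace.differentiable (F : FockSpace) : Differentiable ℂ F := F.2.1

theorem FockSpace.memLp (F : FockSpace) : MemLp F 2 gaussian := F.2.2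

@[ext]
theorem FockSpace.ext {F G : FockSpace} (h : ∀ z, F z = G z) : F = G :=
  Subtype.ext (funext h)

theorem FockSpace.add_apply (F G : FockSpace) (z : ℂ) : (F + G) z = F z + G z := rfl

theorem FockSpace.smul_apply (a : ℂ) (F : FockSpace) (z : ℂ) : (a • F) z = a * F z := rfl

theorem FockSpace.zero_apply (z : ℂ) : (0 : FockSpace) z = 0 := rfl

theorem FockSpace.inner_eq (F G : FockSpace) :
    inner ℂ F G = ∫ w, G w * (starRingEnd ℂ) (F w) ∂gaussian := by
  change inner ℂ (toL2 F) (toL2 G) = _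
  rw [L2.inner_def]
  refine integral_congr_ae ?_
  filter_upwards [F.memLp.coeFn_toLp, G.memLp.coeFn_toLp] with w h1 h2
  change inner ℂ (F.memLp.toLp _ w) (G.memLp.toLp _ w) = _
  rw [h1, h2, RCLike.inner_apply]

theorem FockSpace.integrable_mul_conj (F G : FockSpace) :
    Integrable (fun w => G w * (starRingEnd ℂ) (F w)) gaussian :=
  G.memLp.integrable_mul F.memLp.star

theorem FockSpace.enorm_eq (F : FockSpace) : ‖F‖ₑ = eLpNorm F 2 gaussian := by
  change ‖toL2 F‖ₑ = _
  exact Lp.enorm_toLp F.memLp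

/-- The reproducing property of the Fock space. -/
theorem inner_fockKer (z : ℂ) (F : FockSpace) : inner ℂ (fockKer z) F = F z := by
  have hint := FockSpace.integrable_mul_conj (fockKer z) F
  rw [FockSpace.inner_eq]
  have hconj : ∀ w, (starRingEnd ℂ) (fockKer z w) = Complex.exp (z * (starRingEnd ℂ) w) := by
    intro w
    rw [fockKer_apply, ← Complex.exp_conj]
    simp [mul_comm]
  simp only [hconj] at hint ⊢
  -- The translate of `F`, twisted so that it stays integrable for the Gaussian measure, with `g 0 =
  -- F z`.
  set g : ℂ → ℂ := fun w => F (w + z) * Complex.exp (-(w * (starRingEnd ℂ) z)) with hg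
  have hgd : Differentiable ℂ g := by
    have := F.differentiable
    refine Differentiable.mul (this.comp (by fun_prop)) (by fun_prop)
  have key : ∀ w, (gaussDensity (w - z) : ℂ) * g (w - z) =
      gaussDensity w * (F w * Complex.exp (z * (starRingEnd ℂ) w)) := by
    intro w
    rw [hg, mul_left_comm _ (F w), ← gaussDensity_mul_exp]
    simp only [sub_add_cancel]
    ring
  have hgi : Integrable g gaussian := by
    rw [integrable_gaussian_iff] at hint ⊢
    simp_rw [← key] at hint
    simpa using hint.comp_add_right z
  have h := integral_gaussian_of_differentiable hgd hgi
  rw [integral_gaussian_eq, ← integral_sub_right_eq_self _ z] at h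
  simp_rw [key] at h
  rw [integral_gaussian_eq, h]
  simp [hg]

/-! ### Coherent states and unitarity of the Bargmann transform -/

/-- The normalizing constant of the Bargmann transform. -/
def bargmannConst : ℝ := (2 / Real.pi) ^ (1 / 4 : ℝ)

/-- The function on `ℝ` which the Bargmann transform sends to the reproducing kernel at `z`: the
complex conjugate of the integral kernel of the Bargmann transform. -/
def coherent (z : ℂ) (x : ℝ) : ℂ :=
  bargmannConst * Complex.exp (2 * x * (starRingEnd ℂ) z - (x : ℂ) ^ 2 - (starRingEnd ℂ) z ^ 2 / 2)

theorem bargmannConst_pos : 0 < bargmannConst := by unfold bargmannConst; positivity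

theorem continuous_coherent (z : ℂ) : Continuous (coherent z) := by
  unfold coherent; fun_prop

theorem conj_coherent (z : ℂ) (x : ℝ) : (starRingEnd ℂ) (coherent z x) =
    bargmannConst * Complex.exp (2 * x * z - (x : ℂ) ^ 2 - z ^ 2 / 2) := by
  rw [coherent, map_mul, ← Complex.exp_conj]
  simp [map_ofNat]

theorem coherent_mul_conj (z w : ℂ) (s x : ℝ) :
    coherent w (x + s) * (starRingEnd ℂ) (coherent z x) =
      (bargmannConst : ℂ) ^ 2 * Complex.exp ((-2 : ℂ) * x ^ 2 +
        (2 * z + 2 * (starRingEnd ℂ) w - 2 * s) * x +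
        (2 * s * (starRingEnd ℂ) w - s ^ 2 - (starRingEnd ℂ) w ^ 2 / 2 - z ^ 2 / 2)) := by
  rw [conj_coherent, coherent, mul_mul_mul_comm, ← Complex.exp_add, ← sq]
  congr 2
  push_cast
  ring

theorem integrable_coherent_mul_conj (z w : ℂ) (s : ℝ) :
    Integrable fun x => coherent w (x + s) * (starRingEnd ℂ) (coherent z x) := by
  simp_rw [coherent_mul_conj]
  exact (integrable_cexp_quadratic' (by simp) _ _).const_mul _

/-- A Gaussian integral, with `bargmannConst ^ 2` cancelling `√(π/2)`. The case `s = 0` gives the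
reproducing kernel; general `s` serves the Hilbert transform. -/
theorem integral_coherent_mul_conj (z w : ℂ) (s : ℝ) :
    ∫ x, coherent w (x + s) * (starRingEnd ℂ) (coherent z x) =
      Complex.exp (z * (starRingEnd ℂ) w) *
        Complex.exp (-(s * (z - (starRingEnd ℂ) w)) - (s : ℂ) ^ 2 / 2) := by
  simp_rw [coherent_mul_conj]
  rw [integral_const_mul, integral_cexp_quadratic (by simp)]
  have hc : (bargmannConst : ℂ) ^ 2 * (Real.pi / -(-2 : ℂ)) ^ (1 / 2 : ℂ) = 1 := by
    have h1 : (Real.pi / -(-2 : ℂ)) ^ (1 / 2 : ℂ) = ((Real.pi / 2) ^ (1 / 2 : ℝ) : ℝ) := by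
      rw [Complex.ofReal_cpow (by positivity)]
      norm_num
    have h2 : bargmannConst ^ 2 = (2 / Real.pi) ^ (1 / 2 : ℝ) := by
      rw [bargmannConst, ← Real.rpow_natCast, ← Real.rpow_mul (by positivity)]
      norm_num
    rw [h1, ← Complex.ofReal_pow, h2, ← Complex.ofReal_mul,
      ← Real.mul_rpow (by positivity) (by positivity)]
    have : 2 / Real.pi * (Real.pi / 2) = 1 := by
      have := Real.pi_ne_zero
      field_simp
    rw [this]; simp
  rw [← mul_assoc, hc, one_mul, ← Complex.exp_add]
  congr 1
  ring

theorem memLp_coherent (z : ℂ) : MemLp (coherent z) 2 := by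
  rw [memLp_two_iff_integrable_sq_norm (continuous_coherent z).aestronglyMeasurable]
  refine (integrable_coherent_mul_conj z z 0).norm.congr (Eventually.of_forall fun x => ?_)
  simp [sq]

theorem integrable_coherent (z : ℂ) : Integrable (coherent z) := by
  have h := (integrable_cexp_quadratic' (b := -1) (by simp) (2 * (starRingEnd ℂ) z)
    (-(starRingEnd ℂ) z ^ 2 / 2)).const_mul (bargmannConst : ℂ)
  refine h.congr (Eventually.of_forall fun x => ?_)
  simp only [coherent]
  congr 2
  ring

/-- `coherent z` as an element of `L²(ℝ)`. -/
def coherentLp (z : ℂ) : L2R := (memLp_coherent z).toLp _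

theorem coherentLp_ae_eq (z : ℂ) : coherentLp z =ᵐ[volume] coherent z :=
  (memLp_coherent z).coeFn_toLp

theorem inner_coherentLp (z : ℂ) (f : L2R) :
    inner ℂ (coherentLp z) f = ∫ x, f x * (starRingEnd ℂ) (coherent z x) := by
  rw [L2.inner_def]
  refine integral_congr_ae ?_
  filter_upwards [coherentLp_ae_eq z] with x hx
  rw [hx, RCLike.inner_apply]

theorem isBargmannTransform_iff (B : L2R ≃ₗᵢ[ℂ] FockSpace) :
    IsBargmannTransform B ↔ ∀ f z, B f z = inner ℂ (coherentLp z) f := by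
  refine forall_congr' fun f => forall_congr' fun z => ?_
  rw [inner_coherentLp, ← integral_const_mul]
  have : ∀ x : ℝ, f x * (starRingEnd ℂ) (coherent z x) = (((2 / Real.pi) ^ (1 / 4 : ℝ) : ℝ) : ℂ) *
      (f x * Complex.exp (2 * x * z - (x : ℂ) ^ 2 - z ^ 2 / 2)) := fun x => by
    rw [conj_coherent, bargmannConst]; ring
  simp_rw [this]

theorem inner_coherentLp_coherentLp (z w : ℂ) :
    inner ℂ (coherentLp z) (coherentLp w) = Complex.exp (z * (starRingEnd ℂ) w) := by
  have h := integral_coherent_mul_conj z w 0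
  simp only [add_zero, Complex.ofReal_zero, zero_mul, neg_zero, ne_eq, OfNat.ofNat_ne_zero,
    not_false_eq_true, zero_pow, zero_div, sub_zero, Complex.exp_zero, mul_one] at h
  rw [inner_coherentLp, ← h]
  refine integral_congr_ae ?_
  filter_upwards [coherentLp_ae_eq w] with x hx
  rw [hx]

theorem norm_coherentLp_sq (z : ℂ) : ‖coherentLp z‖ ^ 2 = Real.exp (‖z‖ ^ 2) := by
  have h := inner_coherentLp_coherentLp z z
  rw [inner_self_eq_norm_sq_to_K, Complex.mul_conj'] at h
  apply Complex.ofReal_injective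
  push_cast
  exact h

/-- Fourier uniqueness in `L¹`: a smooth compactly supported test function is the Fourier transform
of a Schwartz function, and the transform moves over to `g`. -/
theorem ae_eq_zero_of_integral_mul_exp_eq_zero {g : ℝ → ℂ} (hg : Integrable g)
    (h : ∀ y : ℝ, ∫ x, g x * Complex.exp (2 * x * (y * Complex.I)) = 0) : g =ᵐ[volume] 0 := by
  have hF : ∀ y, FourierTransform.fourier g y = 0 := by
    intro y
    rw [Real.fourier_eq', ← h (-(Real.pi * y))]
    refine integral_congr_ae (Eventually.of_forall fun x => ?_)
    simp only [smul_eq_mul, mul_comm (g x)]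
    congr 2
    simp
    ring
  refine ae_eq_zero_of_integral_contDiff_smul_eq_zero hg.locallyIntegrable fun ψ hψ hψc => ?_
  have hc : HasCompactSupport (Complex.ofRealCLM ∘ ψ) := hψc.comp_left rfl
  set Ψ : SchwartzMap ℝ ℂ := hc.toSchwartzMap (Complex.ofRealCLM.contDiff.comp hψ) with hΨ
  obtain ⟨Φ, hΦ⟩ : ∃ Φ : SchwartzMap ℝ ℂ, FourierTransform.fourier Φ = Ψ :=
    ⟨_, FourierTransform.fourier_fourierInv_eq Ψ⟩
  have hΦe : ∀ x, FourierTransform.fourier Φ x = (ψ x : ℂ) := fun x => by rw [hΦ]; rfl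
  have := VectorFourier.integral_fourierIntegral_smul_eq_flip (L := innerₗ ℝ)
    Real.continuous_fourierChar continuous_inner (Φ.integrable (μ := volume)) hg
  calc ∫ x, ψ x • g x
      = ∫ x, FourierTransform.fourier Φ x • g x := by simp_rw [hΦe]; rfl
    _ = ∫ x, Φ x • FourierTransform.fourier g x := by
        rw [flip_innerₗ] at this
        rw [SchwartzMap.fourier_coe]
        exact this
    _ = 0 := by simp [hF]

theorem eq_zero_of_inner_coherentLp_eq_zero {f : L2R} (h : ∀ z, inner ℂ (coherentLp z) f = 0) :
    f = 0 := by
  have hg : Integrable fun x => f x * (starRingEnd ℂ) (coherent 0 x) :=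
    (Lp.memLp f).integrable_mul (memLp_coherent 0).star
  have h0 := ae_eq_zero_of_integral_mul_exp_eq_zero hg fun y => by
    -- Imaginary `z` suffices: there the pairing is, up to a nonzero factor, the Fourier transform
    -- of `f` times a Gaussian.
    have hy := h (y * Complex.I)
    rw [inner_coherentLp] at hy
    have e : ∀ x : ℝ, f x * (starRingEnd ℂ) (coherent 0 x) *
        Complex.exp (2 * x * (y * Complex.I)) =
        Complex.exp ((y * Complex.I) ^ 2 / 2) *
          (f x * (starRingEnd ℂ) (coherent (y * Complex.I) x)) := fun x => by
      rw [conj_coherent, conj_coherent]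
      have : (2 : ℂ) * x * (y * Complex.I) - x ^ 2 - (y * Complex.I) ^ 2 / 2 =
        -((y * Complex.I) ^ 2 / 2) + (2 * x * 0 - x ^ 2 - 0 ^ 2 / 2) + 2 * x * (y * Complex.I) := by
        ring
      rw [this, Complex.exp_add, Complex.exp_add, Complex.exp_neg]
      field_simp [Complex.exp_ne_zero]
    simp_rw [e]
    rw [integral_const_mul, hy, mul_zero]
  rw [Lp.eq_zero_iff_ae_eq_zero]
  filter_upwards [h0] with x hx
  have hne : (starRingEnd ℂ) (coherent 0 x) ≠ 0 := by
    rw [conj_coherent]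
    exact mul_ne_zero (by exact_mod_cast bargmannConst_pos.ne') (Complex.exp_ne_zero _)
  exact (mul_eq_zero.1 hx).resolve_right hne

/-- The span of the coherent states. -/
def coherentSpan : Submodule ℂ L2R := Submodule.span ℂ (Set.range coherentLp)

theorem dense_coherentSpan : Dense (coherentSpan : Set L2R) := by
  rw [Submodule.dense_iff_topologicalClosure_eq_top,
    Submodule.topologicalClosure_eq_top_iff, Submodule.eq_bot_iff]
  intro f hf
  refine eq_zero_of_inner_coherentLp_eq_zero fun z => ?_
  exact (Submodule.mem_orthogonal _ _).1 hf _ (Submodule.subset_span ⟨z, rfl⟩)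

theorem exists_fock_of_mem_coherentSpan {f : L2R} (hf : f ∈ coherentSpan) :
    ∃ F : FockSpace, ∀ z, F z = inner ℂ (coherentLp z) f := by
  induction hf using Submodule.span_induction with
  | mem f hf =>
    obtain ⟨w, rfl⟩ := hf
    exact ⟨fockKer w, fun z => by rw [inner_coherentLp_coherentLp, fockKer_apply]⟩
  | zero => exact ⟨0, fun z => by rw [inner_zero_right, FockSpace.zero_apply]⟩
  | add f g _ _ hf hg =>
    obtain ⟨F, hF⟩ := hf
    obtain ⟨G, hG⟩ := hg
    exact ⟨F + G, fun z => by rw [inner_add_right, FockSpace.add_apply, hF, hG]⟩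
  | smul a f _ hf =>
    obtain ⟨F, hF⟩ := hf
    exact ⟨a • F, fun z => by rw [inner_smul_right, FockSpace.smul_apply, hF]⟩

/-- For `f` a coherent state at `w`, both sides are `G w`, by the reproducing property on the left
and the hypothesis on the right. Linearity does the rest. -/
theorem inner_fock_eq_of_mem_coherentSpan {f g : L2R} {F G : FockSpace} (hf : f ∈ coherentSpan)
    (hF : ∀ z, F z = inner ℂ (coherentLp z) f) (hG : ∀ z, G z = inner ℂ (coherentLp z) g) :
    inner ℂ F G = inner ℂ f g := by
  induction hf using Submodule.span_induction generalizing F with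
  | mem f hf =>
    obtain ⟨w, rfl⟩ := hf
    have : F = fockKer w := FockSpace.ext fun z => by
      rw [hF, inner_coherentLp_coherentLp, fockKer_apply]
    rw [this, inner_fockKer, hG]
  | zero =>
    have : F = 0 := FockSpace.ext fun z => by rw [hF, inner_zero_right, FockSpace.zero_apply]
    rw [this, inner_zero_left, inner_zero_left]
  | add f₁ f₂ h₁ h₂ ih₁ ih₂ =>
    obtain ⟨F₁, hF₁⟩ := exists_fock_of_mem_coherentSpan h₁
    obtain ⟨F₂, hF₂⟩ := exists_fock_of_mem_coherentSpan h₂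
    have : F = F₁ + F₂ := FockSpace.ext fun z => by
      rw [hF, inner_add_right, FockSpace.add_apply, hF₁, hF₂]
    rw [this, inner_add_left, inner_add_left, ih₁ hF₁, ih₂ hF₂]
  | smul a f h ih =>
    obtain ⟨F', hF'⟩ := exists_fock_of_mem_coherentSpan h
    have : F = a • F' := FockSpace.ext fun z => by
      rw [hF, inner_smul_right, FockSpace.smul_apply, hF']
    rw [this, inner_smul_left, inner_smul_left, ih hF']

theorem norm_fock_eq_of_mem_coherentSpan {f : L2R} {F : FockSpace} (hf : f ∈ coherentSpan)
    (hF : ∀ z, F z = inner ℂ (coherentLp z) f) : ‖F‖ = ‖f‖ := by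
  have h := inner_fock_eq_of_mem_coherentSpan hf hF hF
  rw [inner_self_eq_norm_sq_to_K, inner_self_eq_norm_sq_to_K] at h
  have h' : ‖F‖ ^ 2 = ‖f‖ ^ 2 := by exact_mod_cast h
  exact (sq_eq_sq₀ (norm_nonneg _) (norm_nonneg _)).1 h'

theorem exists_seq_fock (f : L2R) : ∃ (u : ℕ → L2R) (F : ℕ → FockSpace),
    (∀ n, u n ∈ coherentSpan) ∧ (∀ n z, F n z = inner ℂ (coherentLp z) (u n)) ∧
      Tendsto u atTop (𝓝 f) := by
  obtain ⟨u, hu, hlim⟩ := mem_closure_iff_seq_limit.1 (dense_coherentSpan f)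
  choose F hF using fun n => exists_fock_of_mem_coherentSpan (hu n)
  exact ⟨u, F, hu, hF, hlim⟩

/-- Approximating `f` from the span gives entire functions, and `‖coherentLp z‖ = exp (‖z‖² / 2)` is
bounded on compact sets, so they converge locally uniformly. -/
theorem differentiable_inner_coherentLp (f : L2R) :
    Differentiable ℂ fun z => inner ℂ (coherentLp z) f := by
  obtain ⟨u, F, -, hF, hlim⟩ := exists_seq_fock f
  have hloc : TendstoLocallyUniformlyOn (fun n z => F n z) (fun z => inner ℂ (coherentLp z) f)
      atTop Set.univ := by
    rw [tendstoLocallyUniformlyOn_iff_forall_isCompact isOpen_univ]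
    intro K _ hK
    obtain ⟨R, hR⟩ := hK.isBounded.exists_norm_le
    rw [Metric.tendstoUniformlyOn_iff]
    intro e he
    have hl : Tendsto (fun n => √(Real.exp (R ^ 2)) * ‖f - u n‖) atTop (𝓝 0) := by
      have := (tendsto_iff_norm_sub_tendsto_zero.1 hlim).const_mul √(Real.exp (R ^ 2))
      simpa [norm_sub_rev] using this
    filter_upwards [hl.eventually (gt_mem_nhds he)] with n hn z hz
    rw [dist_eq_norm, hF, ← inner_sub_right]
    refine (norm_inner_le_norm _ _).trans_lt (lt_of_le_of_lt ?_ hn)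
    gcongr
    refine Real.le_sqrt_of_sq_le ?_
    rw [norm_coherentLp_sq]
    gcongr
    exact hR z hz
  have := hloc.differentiableOn
    (Eventually.of_forall fun n => (F n).differentiable.differentiableOn)
    isOpen_univ
  exact differentiableOn_univ.1 this

/-- Fatou's lemma along an approximating sequence from the span, where the norm is already
preserved. -/
theorem eLpNorm_inner_coherentLp_le (f : L2R) :
    eLpNorm (fun z => inner ℂ (coherentLp z) f) 2 gaussian ≤ ‖f‖ₑ := by
  obtain ⟨u, F, hu, hF, hlim⟩ := exists_seq_fock f
  have h := Lp.eLpNorm_lim_le_liminf_eLpNorm (p := 2) (μ := gaussian) (f := fun n z => F n z)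
    (fun n => (F n).memLp.1) (fun z => inner ℂ (coherentLp z) f) (Eventually.of_forall fun z => by
      simp_rw [hF]
      exact tendsto_const_nhds.inner hlim)
  refine h.trans (le_of_eq ?_)
  have h2 : ∀ n, eLpNorm (fun z => F n z) 2 gaussian = ‖u n‖ₑ := fun n => by
    rw [← FockSpace.enorm_eq, ← ofReal_norm, ← ofReal_norm,
      norm_fock_eq_of_mem_coherentSpan (hu n) (hF n)]
  simp_rw [h2]
  exact hlim.enorm.liminf_eq

/-- The Bargmann transform as a linear map. -/
def bargmannLinear : L2R →ₗ[ℂ] FockSpace where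
  toFun f := ⟨fun z => inner ℂ (coherentLp z) f, differentiable_inner_coherentLp f,
    (differentiable_inner_coherentLp f).continuous.aestronglyMeasurable,
    (eLpNorm_inner_coherentLp_le f).trans_lt enorm_lt_top⟩
  map_add' _ _ := FockSpace.ext fun _ => inner_add_right _ _ _
  map_smul' _ _ := FockSpace.ext fun _ => inner_smul_right _ _ _

theorem bargmannLinear_apply (f : L2R) (z : ℂ) :
    bargmannLinear f z = inner ℂ (coherentLp z) f := rfl

theorem norm_bargmannLinear_le (f : L2R) : ‖bargmannLinear f‖ ≤ ‖f‖ := by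
  rw [← enorm_le_iff_norm_le, FockSpace.enorm_eq]
  exact eLpNorm_inner_coherentLp_le f

theorem norm_bargmannLinear (f : L2R) : ‖bargmannLinear f‖ = ‖f‖ := by
  have hc : Continuous bargmannLinear :=
    (bargmannLinear.mkContinuous 1 (by simpa using norm_bargmannLinear_le)).continuous
  refine dense_coherentSpan.induction (P := fun f => ‖bargmannLinear f‖ = ‖f‖) (fun f hf => ?_)
    (isClosed_eq (by fun_prop) (by fun_prop)) f
  exact norm_fock_eq_of_mem_coherentSpan hf (bargmannLinear_apply f)

/-- The Bargmann transform as a linear isometry. -/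
def bargmannIsometry : L2R →ₗᵢ[ℂ] FockSpace := ⟨bargmannLinear, norm_bargmannLinear⟩

theorem surjective_bargmannIsometry : Function.Surjective bargmannIsometry := by
  intro F
  -- The preimage is the adjoint applied to `F`. Riesz is used in `L²(ℝ)`, so completeness of the
  -- Fock space is not needed.
  refine ⟨(InnerProductSpace.toDual ℂ L2R).symm
    ((innerSL ℂ F).comp bargmannIsometry.toContinuousLinearMap), FockSpace.ext fun z => ?_⟩
  change inner ℂ (coherentLp z) _ = _
  rw [← inner_conj_symm, InnerProductSpace.toDual_symm_apply]
  change (starRingEnd ℂ) (inner ℂ F (bargmannLinear (coherentLp z))) = _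
  have : bargmannLinear (coherentLp z) = fockKer z := FockSpace.ext fun w => by
    rw [bargmannLinear_apply, inner_coherentLp_coherentLp, fockKer_apply]
  rw [inner_conj_symm, this, inner_fockKer]

/-- The Bargmann transform as a unitary operator. -/
def bargmannEquiv : L2R ≃ₗᵢ[ℂ] FockSpace :=
  LinearIsometryEquiv.ofSurjective bargmannIsometry surjective_bargmannIsometry

theorem isBargmannTransform_bargmannEquiv : IsBargmannTransform bargmannEquiv := by
  rw [isBargmannTransform_iff]
  intro f z
  rfl

/-! ### Integral kernels of conjugated operators -/

/-- The conjugate `B T B⁻¹` of a bounded operator `T` by a Bargmann transform is the integral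
operator with kernel `⟨coherent z, T coherent w⟩`. -/
theorem IsBargmannTransform.integral_kernel {B : L2R ≃ₗᵢ[ℂ] FockSpace}
    (hB : IsBargmannTransform B) (T : L2R →L[ℂ] L2R) (F : FockSpace) (z : ℂ) :
    Integrable (fun w => F w * inner ℂ (coherentLp z) (T (coherentLp w))) gaussian ∧
      B (T (B.symm F)) z =
        ∫ w, F w * inner ℂ (coherentLp z) (T (coherentLp w)) ∂gaussian := by
  rw [isBargmannTransform_iff] at hB
  -- The kernel in `w` is the conjugate of the Fock function `B k`, which gives absolute
  -- convergence.
  set k := ContinuousLinearMap.adjoint T (coherentLp z) with hk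
  have hker : ∀ w, (starRingEnd ℂ) (B k w) = inner ℂ (coherentLp z) (T (coherentLp w)) := by
    intro w
    rw [hB, inner_conj_symm, hk, ContinuousLinearMap.adjoint_inner_left]
  simp_rw [← hker]
  refine ⟨FockSpace.integrable_mul_conj _ _, ?_⟩
  rw [← FockSpace.inner_eq, hB, ← ContinuousLinearMap.adjoint_inner_left, ← hk,
    ← B.inner_map_map, B.apply_symm_apply]

/-! ### Matrix coefficients of the Hilbert transform -/

theorem exists_norm_coherent_sub_le (w : ℂ) :
    ∃ L, 0 ≤ L ∧ ∀ x s : ℝ, ‖coherent w (x + s) - coherent w x‖ ≤ L * |s| := by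
  set r := ‖w‖
  have hder : ∀ x : ℝ, HasDerivAt (coherent w)
      ((2 * (starRingEnd ℂ) w - 2 * x) * coherent w x) x := by
    intro x
    have h1 : HasDerivAt (fun x : ℝ => (x : ℂ)) 1 x := Complex.ofRealCLM.hasDerivAt (x := x)
    have h2 := (((((h1.const_mul 2).mul_const ((starRingEnd ℂ) w)).sub (h1.pow 2)).sub_const
      ((starRingEnd ℂ) w ^ 2 / 2)).cexp).const_mul (bargmannConst : ℂ)
    refine h2.congr_deriv ?_
    simp only [coherent]
    norm_num
    ring
  have hc := bargmannConst_pos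
  -- Completing the square in `t = |x| - r` bounds the exponent by `-t² + 3 r² / 2`, and both `exp
  -- (-t²)` and `|t| exp (-t²)` are at most `1`.
  have hbound : ∀ x : ℝ, ‖(2 * (starRingEnd ℂ) w - 2 * x) * coherent w x‖ ≤
      (4 * r + 2) * (bargmannConst * Real.exp (3 * r ^ 2 / 2)) := by
    intro x
    have h1 : ‖2 * (starRingEnd ℂ) w - 2 * (x : ℂ)‖ ≤ 4 * r + 2 * (|(|x| - r)|) := by
      refine (norm_sub_le _ _).trans ?_
      simp only [norm_mul, Complex.norm_ofNat, RCLike.norm_conj, Complex.norm_real,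
        Real.norm_eq_abs]
      linarith [le_abs_self (|x| - r)]
    have h2 : ‖coherent w x‖ ≤
        bargmannConst * (Real.exp (3 * r ^ 2 / 2) * Real.exp (-(|x| - r) ^ 2)) := by
      rw [coherent, norm_mul, Complex.norm_real, Real.norm_of_nonneg hc.le, Complex.norm_exp,
        ← Real.exp_add]
      gcongr
      have e1 : (2 * (x : ℂ) * (starRingEnd ℂ) w).re ≤ 2 * |x| * r := by
        refine (Complex.re_le_norm _).trans (le_of_eq ?_)
        simp [r]
      have e2 : -((starRingEnd ℂ) w ^ 2 / 2).re ≤ r ^ 2 / 2 := by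
        refine (neg_le_abs _).trans ((Complex.abs_re_le_norm _).trans (le_of_eq ?_))
        simp [r]
      have e3 : ((x : ℂ) ^ 2).re = |x| ^ 2 := by
        rw [← Complex.ofReal_pow, Complex.ofReal_re, sq_abs]
      rw [Complex.sub_re, Complex.sub_re, e3]
      nlinarith
    set t := |x| - r
    have h3 : Real.exp (-t ^ 2) ≤ 1 := Real.exp_le_one_iff.2 (by nlinarith [sq_nonneg t])
    have h4 : |t| * Real.exp (-t ^ 2) ≤ 1 := by
      rw [Real.exp_neg, ← div_eq_mul_inv, div_le_one (Real.exp_pos _)]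
      refine le_trans ?_ (Real.add_one_le_exp _)
      nlinarith [sq_abs t, abs_nonneg t, sq_nonneg (|t| - 1)]
    rw [norm_mul]
    have hr : 0 ≤ r := norm_nonneg _
    calc _ ≤ (4 * r + 2 * |t|) *
          (bargmannConst * (Real.exp (3 * r ^ 2 / 2) * Real.exp (-t ^ 2))) := by
          gcongr
      _ = (4 * r * Real.exp (-t ^ 2) + 2 * (|t| * Real.exp (-t ^ 2))) *
          (bargmannConst * Real.exp (3 * r ^ 2 / 2)) := by ring
      _ ≤ (4 * r * 1 + 2 * 1) * (bargmannConst * Real.exp (3 * r ^ 2 / 2)) := by gcongr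
      _ = _ := by ring
  refine ⟨(4 * r + 2) * (bargmannConst * Real.exp (3 * r ^ 2 / 2)), ?_, fun x s => ?_⟩
  rotate_left
  · have := convex_univ.norm_image_sub_le_of_norm_hasDerivWithin_le
      (fun x _ => (hder x).hasDerivWithinAt) (fun x _ => hbound x) (Set.mem_univ x)
      (Set.mem_univ (x + s))
    simpa using this
  · have : 0 ≤ r := norm_nonneg _
    positivity

theorem abs_truncKer_le_inv {ε : ℝ} (hε : 0 < ε) (s : ℝ) : |truncKer ε s| ≤ ε⁻¹ := by
  unfold truncKer
  split_ifs with h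
  · rw [one_div, abs_inv]; gcongr
  · simp [hε.le]

theorem truncKer_neg (ε s : ℝ) : truncKer ε (-s) = -truncKer ε s := by
  simp only [truncKer, abs_neg]
  split_ifs
  · ring
  · ring

theorem integrable_mul_truncKer {u : ℝ → ℂ} (hu : Integrable u) {ε : ℝ} (hε : 0 < ε) :
    Integrable fun s => u s * truncKer ε s :=
  hu.mul_bdd (c := ε⁻¹) (measurable_truncKer ε).complex_ofReal.aestronglyMeasurable
    (Eventually.of_forall fun s => by
      rw [Complex.norm_real]; exact abs_truncKer_le_inv hε s)

/-- Uniformity in `ε` and `x` supplies the dominating function for the principal value. On `[-1, 1]`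
oddness allows subtracting `coherent w x`, and the Lipschitz bound absorbs `1 / s`; outside, the
kernel is at most `1`. -/
theorem exists_norm_integral_coherent_truncKer_le (w : ℂ) :
    ∃ C, ∀ ε > 0, ∀ x : ℝ, ‖∫ s, coherent w (x + s) * truncKer ε s‖ ≤ C := by
  obtain ⟨L, hL0, hL⟩ := exists_norm_coherent_sub_le w
  refine ⟨(∫ s, (Set.Icc (-1 : ℝ) 1).indicator (fun _ => L) s) + ∫ s, ‖coherent w s‖,
    fun ε hε x => ?_⟩
  have hφ : Integrable fun s => coherent w (x + s) := (integrable_coherent w).comp_add_left x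
  have hind : Integrable ((Set.Icc (-1 : ℝ) 1).indicator fun _ => coherent w x) :=
    (integrable_indicator_iff measurableSet_Icc).2 (integrableOn_const (by simp))
  have hindL : Integrable ((Set.Icc (-1 : ℝ) 1).indicator fun _ => L) :=
    (integrable_indicator_iff measurableSet_Icc).2 (integrableOn_const (by simp))
  have h0 : ∫ s, (Set.Icc (-1 : ℝ) 1).indicator (fun _ => coherent w x) s * truncKer ε s = 0 := by
    refine integral_odd_eq_zero fun s => ?_
    have : -s ∈ Set.Icc (-1 : ℝ) 1 ↔ s ∈ Set.Icc (-1 : ℝ) 1 := by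
      simp only [Set.mem_Icc]; constructor <;> rintro ⟨h1, h2⟩ <;> constructor <;> linarith
    rw [truncKer_neg]
    simp only [Set.indicator, this]
    push_cast; ring
  have h1 : ∫ s, coherent w (x + s) * truncKer ε s =
      ∫ s, (coherent w (x + s) * truncKer ε s -
        (Set.Icc (-1 : ℝ) 1).indicator (fun _ => coherent w x) s * truncKer ε s) := by
    rw [integral_sub (integrable_mul_truncKer hφ hε) (integrable_mul_truncKer hind hε), h0,
      sub_zero]
  rw [h1, ← integral_add_left_eq_self (fun s => ‖coherent w s‖) x,
    ← integral_add hindL hφ.norm]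
  refine norm_integral_le_of_norm_le (hindL.add hφ.norm) (Eventually.of_forall fun s => ?_)
  rw [← sub_mul, norm_mul, Complex.norm_real, Real.norm_eq_abs]
  by_cases hs : s ∈ Set.Icc (-1 : ℝ) 1
  · simp only [Set.indicator_of_mem hs]
    have ht : |s| * |truncKer ε s| ≤ 1 := by
      unfold truncKer
      split_ifs with h
      · rw [one_div, abs_inv]; exact mul_inv_le_one
      · simp
    calc _ ≤ L * |s| * |truncKer ε s| := by gcongr; exact hL x s
      _ = L * (|s| * |truncKer ε s|) := by ring
      _ ≤ L * 1 := by gcongr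
      _ ≤ _ := by linarith [norm_nonneg (coherent w (x + s))]
  · simp only [Set.indicator_of_notMem hs, sub_zero, zero_add]
    have hs' : 1 ≤ |s| := by
      by_contra h
      exact hs (abs_le.1 (not_le.1 h).le)
    have ht : |truncKer ε s| ≤ 1 := by
      unfold truncKer
      split_ifs with h
      · rw [one_div, abs_inv]; exact inv_le_one_of_one_le₀ hs'
      · simp
    exact mul_le_of_le_one_right (norm_nonneg _) ht

theorem integrable_coherent_mul_truncKer_mul_conj (z w : ℂ) {ε : ℝ} (hε : 0 < ε) :
    Integrable (Function.uncurry fun x s : ℝ =>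
      coherent w (x + s) * truncKer ε s * (starRingEnd ℂ) (coherent z x))
      (volume.prod volume) := by
  have hc : Continuous fun p : ℝ × ℝ =>
      coherent w (p.1 + p.2) * (starRingEnd ℂ) (coherent z p.1) :=
    ((continuous_coherent w).comp (continuous_fst.add continuous_snd)).mul
      (Complex.continuous_conj.comp ((continuous_coherent z).comp continuous_fst))
  have h1 : Integrable (fun p : ℝ × ℝ =>
      coherent w (p.1 + p.2) * (starRingEnd ℂ) (coherent z p.1)) (volume.prod volume) := by
    rw [integrable_prod_iff hc.aestronglyMeasurable]
    refine ⟨Eventually.of_forall fun x => ((integrable_coherent w).comp_add_left x).mul_const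
      ((starRingEnd ℂ) (coherent z x)), ?_⟩
    have : ∀ x : ℝ, ∫ s, ‖coherent w (x + s) * (starRingEnd ℂ) (coherent z x)‖ =
        (∫ s, ‖coherent w s‖) * ‖coherent z x‖ := fun x => by
      simp_rw [norm_mul, RCLike.norm_conj]
      rw [integral_mul_const, integral_add_left_eq_self (fun s => ‖coherent w s‖) x]
    simp_rw [this]
    exact (integrable_coherent z).norm.const_mul _
  have h2 := h1.mul_bdd (g := fun p : ℝ × ℝ => (truncKer ε p.2 : ℂ)) (c := ε⁻¹)
    ((measurable_truncKer ε).comp measurable_snd).complex_ofReal.aestronglyMeasurable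
    (Eventually.of_forall fun p => by
      rw [Complex.norm_real]; exact abs_truncKer_le_inv hε p.2)
  refine h2.congr (Eventually.of_forall fun p => ?_)
  simp only [Function.uncurry]
  ring

theorem integral_integral_coherent_truncKer (z w : ℂ) {ε : ℝ} (hε : 0 < ε) :
    ∫ x, (∫ s, coherent w (x + s) * truncKer ε s) * (starRingEnd ℂ) (coherent z x) =
      Complex.exp (z * (starRingEnd ℂ) w) *
        ∫ s : ℝ, Complex.exp (-(s * (z - (starRingEnd ℂ) w)) - (s : ℂ) ^ 2 / 2) *
          truncKer ε s := by
  simp_rw [← integral_mul_const]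
  rw [integral_integral_swap (integrable_coherent_mul_truncKer_mul_conj z w hε),
    ← integral_const_mul]
  refine integral_congr_ae (Eventually.of_forall fun s => ?_)
  simp only
  rw [← mul_assoc, ← integral_coherent_mul_conj, ← integral_mul_const]
  refine integral_congr_ae (Eventually.of_forall fun x => ?_)
  simp only
  ring

theorem integrable_exp_linear_sub_sq (a : ℂ) :
    Integrable fun s : ℝ => Complex.exp (-(s * a) - (s : ℂ) ^ 2 / 2) := by
  refine (integrable_cexp_quadratic' (b := -1 / 2) (by norm_num) (-a) 0).congr
    (Eventually.of_forall fun s => ?_)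
  simp only
  congr 1
  ring

theorem integral_exp_linear_sub_sq (a : ℂ) :
    ∫ s : ℝ, Complex.exp (-(s * a) - (s : ℂ) ^ 2 / 2) =
      √(2 * Real.pi) * Complex.exp (a ^ 2 / 2) := by
  have h := integral_cexp_quadratic (b := -1 / 2) (by norm_num) (-a) 0
  have h1 : ((Real.pi : ℂ) / -(-1 / 2)) ^ (1 / 2 : ℂ) = √(2 * Real.pi) := by
    rw [Real.sqrt_eq_rpow, Complex.ofReal_cpow (by positivity)]
    push_cast
    congr 1
    ring
  rw [h1] at h
  rw [show a ^ 2 / 2 = 0 - (-a) ^ 2 / (4 * (-1 / 2)) by ring, ← h]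
  congr 1
  ext s
  congr 1
  ring

theorem integrable_exp_abs_sub_sq (r : ℝ) :
    Integrable fun s : ℝ => Real.exp (r * |s| - s ^ 2 / 2) := by
  have h := (integrable_exp_linear_sub_sq r).norm.add (integrable_exp_linear_sub_sq (-r)).norm
  refine h.mono' (by fun_prop) (Eventually.of_forall fun s => ?_)
  have e1 : ‖Complex.exp (-(s * (r : ℂ)) - (s : ℂ) ^ 2 / 2)‖ = Real.exp (-(s * r) - s ^ 2 / 2) := by
    rw [show -(s * (r : ℂ)) - (s : ℂ) ^ 2 / 2 = ((-(s * r) - s ^ 2 / 2 : ℝ) : ℂ) by push_cast; ring,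
      Complex.norm_exp_ofReal]
  have e2 : ‖Complex.exp (-(s * (-r : ℂ)) - (s : ℂ) ^ 2 / 2)‖ = Real.exp (s * r - s ^ 2 / 2) := by
    rw [show -(s * (-r : ℂ)) - (s : ℂ) ^ 2 / 2 = ((s * r - s ^ 2 / 2 : ℝ) : ℂ) by push_cast; ring,
      Complex.norm_exp_ofReal]
  rw [Pi.add_apply, e1, e2, Real.norm_of_nonneg (Real.exp_pos _).le]
  rcases abs_cases s with ⟨h, -⟩ | ⟨h, -⟩ <;> rw [h]
  · rw [mul_comm r]; linarith [Real.exp_pos (-(s * r) - s ^ 2 / 2)]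
  · rw [mul_neg, mul_comm r]; linarith [Real.exp_pos (s * r - s ^ 2 / 2)]

theorem norm_exp_linear_sub_sq_le (a : ℂ) {θ : ℝ} (h0 : 0 ≤ θ) (h1 : θ ≤ 1) (s : ℝ) :
    ‖Complex.exp (-(s * (θ * a)) - (s : ℂ) ^ 2 / 2)‖ ≤ Real.exp (‖a‖ * |s| - s ^ 2 / 2) := by
  rw [Complex.norm_exp]
  gcongr
  have e1 : ((s : ℂ) ^ 2 / 2).re = s ^ 2 / 2 := by
    rw [show (s : ℂ) ^ 2 / 2 = ((s ^ 2 / 2 : ℝ) : ℂ) by push_cast; ring, Complex.ofReal_re]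
  have e2 : (-(s * (θ * a)) : ℂ).re ≤ ‖a‖ * |s| := by
    refine (Complex.re_le_norm _).trans ?_
    rw [norm_neg, norm_mul, norm_mul, Complex.norm_real, Complex.norm_real, Real.norm_eq_abs,
      Real.norm_of_nonneg h0]
    have : θ * ‖a‖ ≤ ‖a‖ := mul_le_of_le_one_left (norm_nonneg _) h1
    nlinarith [abs_nonneg s]
  rw [Complex.sub_re, e1]
  linarith

theorem integral_exp_segment (a : ℂ) (s : ℝ) :
    (s : ℂ) * ∫ θ in (0 : ℝ)..1, -a * Complex.exp (-(s * (θ * a)) - (s : ℂ) ^ 2 / 2) =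
      Complex.exp (-(s * a) - (s : ℂ) ^ 2 / 2) - Complex.exp (-((s : ℂ) ^ 2 / 2)) := by
  have h : ∀ θ ∈ Set.uIcc (0 : ℝ) 1, HasDerivAt
      (fun θ : ℝ => Complex.exp (-(s * (θ * a)) - (s : ℂ) ^ 2 / 2))
      (s * (-a * Complex.exp (-(s * (θ * a)) - (s : ℂ) ^ 2 / 2))) θ := by
    intro θ _
    have h1 : HasDerivAt (fun θ : ℝ => (θ : ℂ)) 1 θ := Complex.ofRealCLM.hasDerivAt (x := θ)
    refine ((((h1.mul_const a).const_mul (s : ℂ)).fun_neg.sub_const _).cexp).congr_deriv ?_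
    ring
  have h2 := intervalIntegral.integral_eq_sub_of_hasDerivAt h
    (Continuous.intervalIntegrable (by fun_prop) _ _)
  rw [intervalIntegral.integral_const_mul] at h2
  simpa using h2

theorem A_div_sqrt_two (a : ℂ) :
    A (a / (√2 : ℝ)) = (√2 : ℂ)⁻¹ * ∫ θ in (0 : ℝ)..1, a * Complex.exp ((θ * a) ^ 2 / 2) := by
  rw [A, ← intervalIntegral.integral_const_mul]
  refine intervalIntegral.integral_congr fun θ _ => ?_
  have h2 : ((√2 : ℝ) : ℂ) ^ 2 = 2 := by
    rw [← Complex.ofReal_pow, Real.sq_sqrt (by norm_num)]; norm_num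
  have : (θ * (a / (√2 : ℝ)) : ℂ) ^ 2 = (θ * a) ^ 2 / 2 := by
    rw [← h2, ← mul_div_assoc, div_pow]
  simp only [this]
  ring

theorem tendsto_truncKer {s : ℝ} (hs : s ≠ 0) :
    Tendsto (fun ε => truncKer ε s) (𝓝[>] 0) (𝓝 (1 / s)) := by
  refine tendsto_const_nhds.congr' ?_
  filter_upwards [nhdsWithin_le_nhds (gt_mem_nhds (abs_pos.2 hs))] with ε hε
  simp [truncKer, hε]

theorem tendsto_integral_exp_truncKer (a : ℂ) :
    Tendsto (fun ε => ∫ s : ℝ, Complex.exp (-(s * a) - (s : ℂ) ^ 2 / 2) * truncKer ε s)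
      (𝓝[>] 0) (𝓝 (-(2 * (√Real.pi : ℝ)) * A (a / (√2 : ℝ)))) := by
  -- `m` extends `(exp (-s a) - 1) exp (-s²/2) / s` across `s = 0`.
  set m : ℝ → ℂ := fun s =>
    ∫ θ in (0 : ℝ)..1, -a * Complex.exp (-(s * (θ * a)) - (s : ℂ) ^ 2 / 2) with hm
  have hint : Integrable (Function.uncurry fun (θ s : ℝ) =>
      -a * Complex.exp (-(s * (θ * a)) - (s : ℂ) ^ 2 / 2))
      ((volume.restrict (Set.uIoc 0 1)).prod volume) := by
    rw [Set.uIoc_of_le zero_le_one]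
    refine Integrable.const_mul (c := -a) (f := fun p : ℝ × ℝ =>
      Complex.exp (-(p.2 * (p.1 * a)) - (p.2 : ℂ) ^ 2 / 2)) ?_
    refine ((integrable_exp_abs_sub_sq ‖a‖).comp_snd _).mono' (by fun_prop) ?_
    filter_upwards [Measure.quasiMeasurePreserving_fst.ae
      (ae_restrict_mem (measurableSet_Ioc (a := (0 : ℝ)) (b := 1)))] with p hp
    exact norm_exp_linear_sub_sq_le a hp.1.le hp.2 p.2
  have hval : ∫ s, m s = -(2 * (√Real.pi : ℝ)) * A (a / (√2 : ℝ)) := by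
    rw [hm, ← intervalIntegral_integral_swap hint]
    simp_rw [integral_const_mul, integral_exp_linear_sub_sq]
    rw [A_div_sqrt_two, ← intervalIntegral.integral_const_mul,
      ← intervalIntegral.integral_const_mul]
    refine intervalIntegral.integral_congr fun θ _ => ?_
    have hs : (√(2 * Real.pi) : ℂ) = 2 * (√Real.pi : ℝ) * (√2 : ℂ)⁻¹ := by
      have : √(2 * Real.pi) = 2 * √Real.pi * (√2)⁻¹ := by
        rw [Real.sqrt_mul (by norm_num)]
        field_simp
        rw [Real.sq_sqrt (by norm_num)]
      rw [this]; push_cast; ring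
    simp only [hs]
    ring
  rw [← hval]
  have hmbound : ∀ s, ‖m s‖ ≤ ‖a‖ * Real.exp (‖a‖ * |s| - s ^ 2 / 2) := by
    intro s
    have := intervalIntegral.norm_integral_le_of_norm_le_const (a := (0 : ℝ)) (b := 1)
      (C := ‖a‖ * Real.exp (‖a‖ * |s| - s ^ 2 / 2))
      (f := fun θ : ℝ => -a * Complex.exp (-(s * (θ * a)) - (s : ℂ) ^ 2 / 2)) (fun θ hθ => by
        rw [Set.uIoc_of_le zero_le_one] at hθ
        rw [norm_mul, norm_neg]
        gcongr
        exact norm_exp_linear_sub_sq_le a hθ.1.le hθ.2 s)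
    rwa [sub_zero, abs_one, mul_one] at this
  have hst : ∀ ε s, |s * truncKer ε s| ≤ 1 := fun ε s => by
    unfold truncKer
    split_ifs with h
    · rw [abs_mul, one_div, abs_inv]; exact mul_inv_le_one
    · simp
  have hmm : AEStronglyMeasurable m volume :=
    hint.integral_prod_right.aestronglyMeasurable.congr (Eventually.of_forall fun s => by
      simp only [hm, Function.uncurry, intervalIntegral.integral_of_le zero_le_one,
        Set.uIoc_of_le (zero_le_one (α := ℝ))])
  -- `s * truncKer ε s` is bounded by `1` and tends to `1` off `s = 0`, so dominated convergence
  -- applies.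
  have hD : Tendsto (fun ε => ∫ s : ℝ, m s * (s * truncKer ε s : ℝ)) (𝓝[>] 0) (𝓝 (∫ s, m s)) := by
    refine tendsto_integral_filter_of_dominated_convergence
      (fun s => ‖a‖ * Real.exp (‖a‖ * |s| - s ^ 2 / 2)) ?_ ?_
      ((integrable_exp_abs_sub_sq _).const_mul _) ?_
    · exact Eventually.of_forall fun ε => hmm.mul
        (measurable_id.mul (measurable_truncKer ε)).complex_ofReal.aestronglyMeasurable
    · refine Eventually.of_forall fun ε => Eventually.of_forall fun s => ?_
      rw [norm_mul, Complex.norm_real]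
      exact (mul_le_of_le_one_right (norm_nonneg _) (hst ε s)).trans (hmbound s)
    · filter_upwards [Measure.ae_ne volume (0 : ℝ)] with s hs
      have h1 := ((tendsto_truncKer hs).const_mul s)
      rw [mul_one_div_cancel hs] at h1
      have h2 := ((Complex.continuous_ofReal.tendsto _).comp h1).const_mul (m s)
      simpa using h2
  refine hD.congr' ?_
  filter_upwards [self_mem_nhdsWithin] with ε (hε : 0 < ε)
  have i1 := integrable_mul_truncKer (integrable_exp_linear_sub_sq a) hε
  have i2 := integrable_mul_truncKer (integrable_exp_linear_sub_sq 0) hε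
  -- An even Gaussian against an odd kernel: this is the term subtracted to cancel the singularity.
  have h0 : ∫ s : ℝ, Complex.exp (-(s * 0) - (s : ℂ) ^ 2 / 2) * truncKer ε s = 0 :=
    integral_odd_eq_zero fun s => by
      rw [truncKer_neg]; push_cast; ring_nf
  rw [← sub_zero (∫ s : ℝ, Complex.exp (-(s * a) - (s : ℂ) ^ 2 / 2) * truncKer ε s), ← h0,
    ← integral_sub i1 i2]
  refine integral_congr_ae (Eventually.of_forall fun s => ?_)
  have := integral_exp_segment a s
  simp only [mul_zero, neg_zero, zero_sub]
  rw [← sub_mul, ← this]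
  push_cast
  ring

/-- The matrix coefficients of the Hilbert transform between coherent states. -/
theorem IsHilbertTransform.inner_coherentLp {H : L2R →L[ℂ] L2R} (hH : IsHilbertTransform H)
    (z w : ℂ) : inner ℂ (coherentLp z) (H (coherentLp w)) =
      -(2 / (√Real.pi : ℂ)) * (Complex.exp (z * (starRingEnd ℂ) w) *
        A ((z - (starRingEnd ℂ) w) / (√2 : ℝ))) := by
  obtain ⟨C, hC⟩ := exists_norm_integral_coherent_truncKer_le w
  -- The almost everywhere principal value passes inside the pairing with `coherent z`, dominated
  -- through the uniform bound `C`.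
  have hlim : Tendsto (fun ε => ∫ x, (1 / (Real.pi : ℂ)) *
      ((∫ s, coherent w (x + s) * truncKer ε s) * (starRingEnd ℂ) (coherent z x)))
      (𝓝[>] 0) (𝓝 (inner ℂ (coherentLp z) (H (coherentLp w)))) := by
    rw [Bargmann.inner_coherentLp]
    refine tendsto_integral_filter_of_dominated_convergence
      (fun x => ‖1 / (Real.pi : ℂ)‖ * (C * ‖coherent z x‖)) ?_ ?_
      (((integrable_coherent z).norm.const_mul _).const_mul _) ?_
    · filter_upwards [self_mem_nhdsWithin] with ε (hε : 0 < ε)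
      have := (integrable_coherent_mul_truncKer_mul_conj z w hε).integral_prod_left
      simp only [Function.uncurry, integral_mul_const] at this
      exact (this.const_mul _).aestronglyMeasurable
    · filter_upwards [self_mem_nhdsWithin] with ε (hε : 0 < ε)
      refine Eventually.of_forall fun x => ?_
      rw [norm_mul, norm_mul, RCLike.norm_conj]
      gcongr
      exact hC ε hε x
    · filter_upwards [hH (coherentLp w)] with x hx
      refine (hx.mul_const ((starRingEnd ℂ) (coherent z x))).congr fun ε => ?_
      rw [← mul_assoc, ← setIntegral_div_sub_eq]
      congr 2
      refine integral_congr_ae (ae_restrict_of_ae ?_)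
      filter_upwards [coherentLp_ae_eq w] with t ht
      rw [ht]
  have hlim2 := ((tendsto_integral_exp_truncKer (z - (starRingEnd ℂ) w)).const_mul
    (Complex.exp (z * (starRingEnd ℂ) w))).const_mul (1 / (Real.pi : ℂ))
  have := tendsto_nhds_unique hlim (hlim2.congr' ?_)
  · rw [this]
    have hπ : (Real.pi : ℂ) = (√Real.pi : ℝ) * (√Real.pi : ℝ) := by
      rw [← Complex.ofReal_mul, Real.mul_self_sqrt Real.pi_pos.le]
    have hne : ((√Real.pi : ℝ) : ℂ) ≠ 0 := by
      exact_mod_cast (Real.sqrt_pos.2 Real.pi_pos).ne'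
    rw [hπ]
    field_simp
  · filter_upwards [self_mem_nhdsWithin] with ε (hε : 0 < ε)
    rw [integral_const_mul, integral_integral_coherent_truncKer z w hε]

end Bargmann

end

/-! ### The integral formula on the Fock space -/

theorem theorem24 :
    (∃ B : Bargmann.L2R ≃ₗᵢ[ℂ] Bargmann.FockSpace, Bargmann.IsBargmannTransform B) ∧
    (∃ H : Bargmann.L2R →L[ℂ] Bargmann.L2R, Bargmann.IsHilbertTransform H) ∧
    ∀ (B : Bargmann.L2R ≃ₗᵢ[ℂ] Bargmann.FockSpace) (H : Bargmann.L2R →L[ℂ] Bargmann.L2R),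
      Bargmann.IsBargmannTransform B → Bargmann.IsHilbertTransform H →
      ∀ (f : Bargmann.FockSpace) (z : ℂ),
        Integrable
          (fun w : ℂ => f w * Complex.exp (z * (starRingEnd ℂ) w) *
            Bargmann.A ((z - (starRingEnd ℂ) w) / (Real.sqrt 2 : ℂ))) Bargmann.gaussian ∧
        (B (H (B.symm f))) z =
          -(2 / (Real.sqrt Real.pi : ℂ)) *
            ∫ w : ℂ, f w * Complex.exp (z * (starRingEnd ℂ) w) *
              Bargmann.A ((z - (starRingEnd ℂ) w) / (Real.sqrt 2 : ℂ)) ∂Bargmann.gaussian := by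
  refine ⟨⟨_, Bargmann.isBargmannTransform_bargmannEquiv⟩,
    ⟨_, Bargmann.isHilbertTransform_hilbertOp⟩, fun B H hB hH f z => ?_⟩
  have h := hB.integral_kernel H f z
  have hne : -(2 / (Real.sqrt Real.pi : ℂ)) ≠ 0 :=
    neg_ne_zero.2 (div_ne_zero two_ne_zero (by
      exact_mod_cast (Real.sqrt_pos.2 Real.pi_pos).ne'))
  have e : ∀ w : ℂ, f w * inner ℂ (Bargmann.coherentLp z) (H (Bargmann.coherentLp w)) =
      -(2 / (Real.sqrt Real.pi : ℂ)) * (f w * Complex.exp (z * (starRingEnd ℂ) w) *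
        Bargmann.A ((z - (starRingEnd ℂ) w) / (Real.sqrt 2 : ℂ))) := fun w => by
    rw [hH.inner_coherentLp]; ring
  simp_rw [e] at h
  refine ⟨?_, ?_⟩
  · refine (h.1.const_mul (-(2 / (Real.sqrt Real.pi : ℂ)))⁻¹).congr
      (Filter.Eventually.of_forall fun w => ?_)
    exact inv_mul_cancel_left₀ hne _
  · rw [h.2, integral_const_mul]
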